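/- Let $\Sigma$ be a closed connected oriented surface of any genus $g\ge 0$, let $n\le 0$ be an integer, and let $r_1,\dots,r_k\in\mathbb Q$ ($k\ge 0$) be such that each $-1/r_i$ is a positive integer. Put $N=|n|+k$ and let $p_1=\dots=p_{|n|}=1$, $p_{|n|+i}=-1/r_i$ for $1\le i\le k$. Choose $N$ disjoint discs in $\Sigma$ with centres $x_1,\dots,x_N$. *The manifold.* Let $Y$ be the closed oriented $3$-manifold with Seifert invariants $(g,n;r_1,\dots,r_k)$ obtained from $S^1\times\Sigma$ by $p_j$-surgery on the fiber $S^1\times\{x_j\}$ for $j=1,\dots,N$: remove the fiber and glue in a solid torus $S^1\times D^2$ with core $C_j$ by the map which on each concentric torus sends the meridian $\mu$ to $p_j m+l$ and the longitude $\lambda$ to $(p_j^2-1)m+p_j l$, where $m$ is the meridian of $S^1\times\{x_j\}$ (the boundary of a disc around $x_j$) and $l$ is the direction of the $S^1$ factor. The orientation of $Y$ extends that of $S^1\times(\Sigma\setminus\{x_1,\dots,x_N\})$. *The Seifert fibration.* The fibers of $Y$ are the oriented circles $S^1\times\{x\}$, $x\in\Sigma\setminus\{x_1,\dots,x_N\}$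 (which in the $j$-th solid torus are the curves $p_j\lambda-(p_j^2-1)\mu$ on the concentric tori), and the cores $C_j$, oriented by $\lambda$. *The open book.* The binding is $C_1\cup\dots\cup C_N$, oriented by $\lambda$ (which is its orientation as boundary of the pages); its complement is $S^1\times(\Sigma\setminus\{x_1,\dots,x_N\})$, and the open book fibration is the projection to $S^1$. The pages are thus the surfaces $\{\theta\}\times(\Sigma\setminus\{x_1,\dots,x_N\})$, oriented by $\Sigma$; near $C_j$ they are annuli which meet the concentric tori in the curves $p_j\mu-\lambda$. A cooriented positive contact structure $\xi$ on $Y$ is compatible with this open book if $\xi=\ker\alpha$, as a cooriented plane field, for a positive contact form $\alpha$ with $\alpha>0$ on the oriented binding and $d\alpha>0$ on every page. Two contact structures are isotopic if they are the ends of a smooth one-parameter family of contact structures. Then the contact structure compatible with this open book (unique up to isotopy) is horizontal: every contact structure $\xi$ on $Y$ that is compatible with the open book is isotopic to a contact structure $\xi'$ which is still compatible with the open book and whose planes are positively transverse to the Seifert fibers at every point of $Y$. -/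

import Mathlib

open scoped Manifold ContDiff Topology

noncomputable section

namespace SeifertOpenBook

open TopologicalSpace

set_option linter.unusedSectionVars false

/-! ### The gluing diffeomorphism of a `p`-surgery

`Circle × ℂ` is an open solid torus `S¹ × D²` (the plane `ℂ` stands for the open disc), with polar
coordinates `w = ‖w‖ * phase w` on the disc factor. -/

/-- The unit complex number `w / ‖w‖` (and `1` for `w = 0`). -/
def phase (w : ℂ) : Circle := Circle.exp w.arg

theorem norm_mul_phase (w : ℂ) : (‖w‖ : ℂ) * (phase w : ℂ) = w := by
  simp [phase, Circle.coe_exp]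

theorem coe_phase {w : ℂ} (hw : w ≠ 0) : (phase w : ℂ) = w / ‖w‖ := by
  have h : (‖w‖ : ℂ) ≠ 0 := by simpa using hw
  rw [eq_div_iff h, mul_comm, norm_mul_phase]

theorem phase_mul_coe {r : ℝ} (hr : 0 < r) (c : Circle) : phase ((r : ℂ) * (c : ℂ)) = c := by
  have h : ((r : ℂ) * (c : ℂ)) ≠ 0 := by simp [hr.ne']
  have : (r : ℂ) ≠ 0 := by simp [hr.ne']
  ext
  rw [coe_phase h, norm_mul, Circle.norm_coe, mul_one, Complex.norm_real, Real.norm_of_nonneg hr.le]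
  field_simp

/-- The gluing map of a `p`-surgery. The source is the solid torus that is glued in: `q.1` is the
longitude angle `λ`, `phase q.2` the meridian angle `μ`. The target is a tubular neighbourhood
`S¹ × D²` of the fibre on which the surgery is performed: the first component is the fibre angle
`l`, the phase of the second component is the meridian angle `m`. The map preserves the radius and
acts on each torus by `μ ↦ p m + l`, `λ ↦ (p² - 1) m + p l`. It is used for `q.2 ≠ 0` only. -/
def glue (p : ℤ) (q : Circle × ℂ) : Circle × ℂ :=
  (phase q.2 * q.1 ^ p, (‖q.2‖ : ℂ) * ((phase q.2 ^ p * q.1 ^ (p ^ 2 - 1) : Circle) : ℂ))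

/-- The inverse of `glue p` off the core. -/
def glueInv (p : ℤ) (q : Circle × ℂ) : Circle × ℂ :=
  ((phase q.2)⁻¹ * q.1 ^ p, (‖q.2‖ : ℂ) * ((phase q.2 ^ p * q.1 ^ (-(p ^ 2 - 1)) : Circle) : ℂ))

theorem glue_snd_ne_zero {p : ℤ} {q : Circle × ℂ} : (glue p q).2 ≠ 0 ↔ q.2 ≠ 0 := by
  rw [glue, mul_ne_zero_iff]
  simp [-Circle.coe_mul, -Circle.coe_zpow, Circle.coe_ne_zero]

theorem glueInv_snd_ne_zero {p : ℤ} {q : Circle × ℂ} : (glueInv p q).2 ≠ 0 ↔ q.2 ≠ 0 := by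
  rw [glueInv, mul_ne_zero_iff]
  simp [-Circle.coe_mul, -Circle.coe_zpow, Circle.coe_ne_zero]

theorem mul_zpow_combine (u z : Circle) (a b c d e f : ℤ) :
    (u ^ a * z ^ b) ^ e * (u ^ c * z ^ d) ^ f = u ^ (a * e + c * f) * z ^ (b * e + d * f) := by
  rw [mul_zpow, mul_zpow, ← zpow_mul, ← zpow_mul, ← zpow_mul, ← zpow_mul, mul_mul_mul_comm,
    ← zpow_add, ← zpow_add]

theorem glueInv_glue {p : ℤ} {q : Circle × ℂ} (hq : q.2 ≠ 0) : glueInv p (glue p q) = q := by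
  have h0 : 0 < ‖q.2‖ := by simpa using hq
  obtain ⟨z, w⟩ := q
  simp only at hq h0
  have h1 := mul_zpow_combine (phase w) z p (p ^ 2 - 1) 1 p (-1) p
  have h2 := mul_zpow_combine (phase w) z p (p ^ 2 - 1) 1 p p (-(p ^ 2 - 1))
  simp only [glueInv, glue, phase_mul_coe h0, norm_mul, Circle.norm_coe, mul_one,
    Complex.norm_real, norm_norm]
  rw [zpow_one, zpow_neg_one] at h1
  rw [zpow_one] at h2
  rw [h1, h2, show p * -1 + 1 * p = 0 by ring, show (p ^ 2 - 1) * -1 + p * p = 1 by ring,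
    show p * p + 1 * -(p ^ 2 - 1) = 1 by ring, show (p ^ 2 - 1) * p + p * -(p ^ 2 - 1) = 0 by ring]
  simp [norm_mul_phase]

theorem glue_glueInv {p : ℤ} {q : Circle × ℂ} (hq : q.2 ≠ 0) : glue p (glueInv p q) = q := by
  have h0 : 0 < ‖q.2‖ := by simpa using hq
  obtain ⟨z, w⟩ := q
  simp only at hq h0
  have h1 := mul_zpow_combine (phase w) z p (-(p ^ 2 - 1)) (-1) p 1 p
  have h2 := mul_zpow_combine (phase w) z p (-(p ^ 2 - 1)) (-1) p p (p ^ 2 - 1)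
  simp only [glueInv, glue, phase_mul_coe h0, norm_mul, Circle.norm_coe, mul_one,
    Complex.norm_real, norm_norm]
  rw [zpow_one, zpow_neg_one] at h1
  rw [zpow_neg_one] at h2
  rw [h1, h2, show p * 1 + -1 * p = 0 by ring, show -(p ^ 2 - 1) * 1 + p * p = 1 by ring,
    show p * p + -1 * (p ^ 2 - 1) = 1 by ring, show -(p ^ 2 - 1) * p + p * (p ^ 2 - 1) = 0 by ring]
  simp [norm_mul_phase]

/-- The complement of the core circle in the open solid torus. -/
def slit : Set (Circle × ℂ) := {q | q.2 ≠ 0}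

theorem isOpen_slit : IsOpen slit := isOpen_ne_fun continuous_snd continuous_const

/-- The model for real 3-manifolds charted on `ℝ¹ × ℂ`, i.e. on `ℝ × ℝ²`, without boundary. -/
abbrev Model3 : ModelWithCorners ℝ (EuclideanSpace ℝ (Fin 1) × ℂ)
    (ModelProd (EuclideanSpace ℝ (Fin 1)) ℂ) := (𝓡 1).prod 𝓘(ℝ, ℂ)

theorem contMDiff_zpow (n : ℤ) : ContMDiff (𝓡 1) (𝓡 1) ∞ (fun z : Circle => z ^ n) := by
  cases n with
  | ofNat n => simpa using contMDiff_pow (I := 𝓡 1) (G := Circle) n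
  | negSucc n =>
    simpa using (contMDiff_pow (I := 𝓡 1) (G := Circle) (n := ∞) (n+1)).inv

theorem contMDiff_coe_circle : ContMDiff (𝓡 1) 𝓘(ℝ, ℂ) ∞ (fun z : Circle => (z : ℂ)) := by
  have := finrank_real_complex_fact'
  exact contMDiff_coe_sphere

theorem contMDiffOn_phase : ContMDiffOn 𝓘(ℝ, ℂ) (𝓡 1) ∞ phase {w | w ≠ 0} := by
  let U : Opens ℂ := ⟨{w | w ≠ 0}, isOpen_ne⟩
  have h : ContMDiff 𝓘(ℝ, ℂ) (𝓡 1) ∞ (fun w : U => phase w) := by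
    have := finrank_real_complex_fact'
    apply ContMDiff.codRestrict_sphere (f := fun w : U => (phase w : ℂ)) (E := ℂ)
    have : (fun w : U => (phase w : ℂ)) = (fun w : ℂ => ‖w‖⁻¹ • w) ∘ (Subtype.val : U → ℂ) := by
      ext w
      rw [coe_phase w.2]
      simp [div_eq_inv_mul]
    rw [this]
    intro w
    refine ContMDiffAt.comp w ?_ contMDiff_subtype_val.contMDiffAt
    rw [contMDiffAt_iff_contDiffAt]
    have hw : (w : ℂ) ≠ 0 := w.2
    exact ((contDiffAt_norm ℝ hw).inv (by simpa using hw)).smul contDiffAt_id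
  intro w hw
  exact (contMDiffAt_subtype_iff (U := U) (x := ⟨w, hw⟩).1 (h ⟨w, hw⟩)).contMDiffWithinAt

theorem contMDiffOn_aux (a b c d : ℤ) : ContMDiffOn Model3 Model3 ∞
    (fun q : Circle × ℂ => (phase q.2 ^ a * q.1 ^ b, 
      (‖q.2‖ : ℂ) * ((phase q.2 ^ c * q.1 ^ d : Circle) : ℂ))) slit := by
  have h1 : ContMDiffOn Model3 (𝓡 1) ∞ (fun q : Circle × ℂ => phase q.2) slit :=
    contMDiffOn_phase.comp contMDiff_snd.contMDiffOn (fun q hq => hq)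
  have h2 : ContMDiffOn Model3 (𝓡 1) ∞ (fun q : Circle × ℂ => q.1) slit :=
    contMDiff_fst.contMDiffOn
  have h3 (a b : ℤ) : ContMDiffOn Model3 (𝓡 1) ∞ 
      (fun q : Circle × ℂ => phase q.2 ^ a * q.1 ^ b) slit := 
    ((contMDiff_zpow a).comp_contMDiffOn h1).mul ((contMDiff_zpow b).comp_contMDiffOn h2)
  refine (h3 a b).prodMk ?_
  have h4 : ContMDiffOn Model3 𝓘(ℝ, ℂ) ∞ (fun q : Circle × ℂ => (‖q.2‖ : ℂ)) slit := by
    have : ContMDiffOn 𝓘(ℝ, ℂ) 𝓘(ℝ, ℂ) ∞ (fun w : ℂ => (‖w‖ : ℂ)) {w | w ≠ 0} := by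
      rw [contMDiffOn_iff_contDiffOn]
      intro w hw
      exact (Complex.ofRealCLM.contDiff.contDiffAt.comp _ (contDiffAt_norm ℝ hw)).contDiffWithinAt
    exact this.comp contMDiff_snd.contMDiffOn (fun q hq => hq)
  have h5 := contMDiff_coe_circle.comp_contMDiffOn (h3 c d)
  have hm : ContMDiff (𝓘(ℝ, ℂ).prod 𝓘(ℝ, ℂ)) 𝓘(ℝ, ℂ) ∞ (fun z : ℂ × ℂ => z.1 * z.2) := by
    rw [contMDiff_iff]
    exact ⟨continuous_mul, fun x y => contDiff_mul.contDiffOn⟩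
  exact hm.comp_contMDiffOn (h4.prodMk h5)

theorem contMDiffOn_glue (p : ℤ) : ContMDiffOn Model3 Model3 ∞ (glue p) slit := by
  have := contMDiffOn_aux 1 p p (p^2-1)
  simpa only [zpow_one] using! this

theorem contMDiffOn_glueInv (p : ℤ) : ContMDiffOn Model3 Model3 ∞ (glueInv p) slit := by
  have := contMDiffOn_aux (-1) p p (-(p^2-1))
  simpa only [zpow_neg_one] using! this


/-! ### Oriented surfaces with disjoint discs

A surface is a manifold charted on `ℂ`, regarded as the real vector space `ℝ²`: all smoothness is
real smoothness, for the model `𝓘(ℝ, ℂ)`. -/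

/-- The atlas of the surface is oriented: every change of charts has positive Jacobian. A basis of
`T_x S = ℂ` is then positively oriented iff it is so in `ℂ`, e.g. the basis `1, I` is. -/
class OrientedAtlas (S : Type*) [TopologicalSpace S] [ChartedSpace ℂ S] : Prop where
  det_pos : ∀ e ∈ atlas ℂ S, ∀ e' ∈ atlas ℂ S, ∀ z ∈ (e.symm ≫ₕ e').source,
    0 < (fderiv ℝ (e.symm ≫ₕ e') z).det

/-- A family of pairwise disjoint, orientation preserving, smoothly embedded open discs in the
surface `S`, each parametrised by the plane `ℂ ≅ D²`. -/
structure DiskSystem (S : Type*) [TopologicalSpace S] [ChartedSpace ℂ S] (J : Type*) where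
  disk : J → ℂ → S
  isLocalDiffeomorph : ∀ j, IsLocalDiffeomorph 𝓘(ℝ, ℂ) 𝓘(ℝ, ℂ) ∞ (disk j)
  injective : ∀ j, Function.Injective (disk j)
  disjoint : Pairwise fun i j => Disjoint (Set.range (disk i)) (Set.range (disk j))
  det_pos : ∀ j w, 0 < (show ℂ →L[ℝ] ℂ from mfderiv 𝓘(ℝ, ℂ) 𝓘(ℝ, ℂ) (disk j) w).det

section
variable {S : Type*} [TopologicalSpace S] [T2Space S] [ChartedSpace ℂ S]
  {J : Type*} [Finite J]

namespace DiskSystem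

theorem eq_of_disk_eq (D : DiskSystem S J) {i j : J} {v w : ℂ} (h : D.disk i v = D.disk j w) :
    i = j ∧ v = w := by
  have hij : i = j := by
    by_contra hne
    exact Set.disjoint_left.1 (D.disjoint hne) ⟨v, rfl⟩ ⟨w, h.symm⟩
  subst hij
  exact ⟨rfl, D.injective i h⟩

/-- The surface minus the centres of the discs; it is diffeomorphic to the interior of the surface
minus smaller closed discs. -/
def punctured (D : DiskSystem S J) : Opens S :=
  ⟨(Set.range fun j => D.disk j 0)ᶜ, (Set.finite_range _).isClosed.isOpen_compl⟩

theorem disk_mem_punctured (D : DiskSystem S J) (j : J) {w : ℂ} (hw : w ≠ 0) :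
    D.disk j w ∈ D.punctured := by
  rintro ⟨i, hi⟩
  exact hw (D.eq_of_disk_eq hi).2.symm

end DiskSystem

/-- The 3-manifold obtained from `S¹ × S` by a `p j`-surgery on the fibre over the centre of the
`j`-th disc, for every `j`. As a set it is the complement `S¹ × (S ∖ centres)` of these fibres
together with the core circles of the solid tori that are glued in. -/
inductive SeifertManifold (D : DiskSystem S J) (p : J → ℤ) : Type _
  | outer (q : Circle × D.punctured) : SeifertManifold D p
  | core (j : J) (z : Circle) : SeifertManifold D p

namespace SeifertManifold

variable {D : DiskSystem S J} {p : J → ℤ}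

variable (D p) in
/-- The `j`-th surgery torus. Off its core it is identified, by the gluing map of the surgery, with
the punctured tubular neighbourhood `S¹ × (disc ∖ centre)` of the `j`-th fibre. -/
def torus (j : J) (q : Circle × ℂ) : SeifertManifold D p :=
  open Classical in
  if h : q.2 = 0 then core j q.1
  else outer ((glue (p j) q).1,
    ⟨D.disk j (glue (p j) q).2, D.disk_mem_punctured j (glue_snd_ne_zero.2 h)⟩)

theorem torus_of_eq {j : J} {q : Circle × ℂ} (h : q.2 = 0) : torus D p j q = core j q.1 := by
  simp [torus, h]

theorem torus_of_ne {j : J} {q : Circle × ℂ} (h : q.2 ≠ 0) :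
    torus D p j q = outer ((glue (p j) q).1,
      ⟨D.disk j (glue (p j) q).2, D.disk_mem_punctured j (glue_snd_ne_zero.2 h)⟩) := by
  simp [torus, h]

theorem torus_eq_torus {i j : J} {q q' : Circle × ℂ} (h : torus D p i q = torus D p j q') :
    i = j ∧ q = q' := by
  by_cases h1 : q.2 = 0 <;> by_cases h2 : q'.2 = 0
  · rw [torus_of_eq h1, torus_of_eq h2, core.injEq] at h
    exact ⟨h.1, Prod.ext h.2 (h1.trans h2.symm)⟩
  · rw [torus_of_eq h1, torus_of_ne h2] at h; cases h
  · rw [torus_of_ne h1, torus_of_eq h2] at h; cases h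
  · rw [torus_of_ne h1, torus_of_ne h2, outer.injEq, Prod.mk.injEq, Subtype.mk.injEq] at h
    obtain ⟨h3, h4⟩ := h
    obtain ⟨rfl, h5⟩ := D.eq_of_disk_eq h4
    refine ⟨rfl, ?_⟩
    rw [← glueInv_glue h1, ← glueInv_glue h2, Prod.ext h3 h5]

/-- The topology glued from those of the piece `S¹ × (S ∖ centres)` and of the surgery tori. -/
instance topology : TopologicalSpace (SeifertManifold D p) :=
  .coinduced outer inferInstance ⊔ ⨆ j, .coinduced (torus D p j) inferInstance

theorem isOpen_iff {U : Set (SeifertManifold D p)} :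
    IsOpen U ↔ IsOpen (outer ⁻¹' U) ∧ ∀ j, IsOpen (torus D p j ⁻¹' U) := by
  change IsOpen[.coinduced outer inferInstance ⊔ ⨆ j, .coinduced (torus D p j) inferInstance] U ↔ _
  exact isOpen_sup.trans (and_congr Iff.rfl isOpen_iSup_iff)

theorem continuous_outer : Continuous (outer : Circle × D.punctured → SeifertManifold D p) :=
  continuous_def.2 fun _ h => (isOpen_iff.1 h).1

theorem continuous_torus (j : J) : Continuous (torus D p j) :=
  continuous_def.2 fun _ h => (isOpen_iff.1 h).2 j

theorem contMDiff_torus_outer (j : J) :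
    ContMDiffOn Model3 Model3 ∞ (fun q : Circle × ℂ => 
      ((glue (p j) q).1, D.disk j (glue (p j) q).2)) slit := by
  have h := contMDiffOn_glue (p j)
  exact (contMDiff_fst.comp_contMDiffOn h).prodMk
    ((D.isLocalDiffeomorph j).contMDiff.comp_contMDiffOn (contMDiff_snd.comp_contMDiffOn h))

theorem isOpenMap_outer : IsOpenMap (outer : Circle × D.punctured → SeifertManifold D p) := by
  intro U hU
  refine isOpen_iff.2 ⟨?_, fun j => ?_⟩
  · convert hU
    ext q; simp
  · obtain ⟨V, hV, rfl⟩ : ∃ V : Set (Circle × S), IsOpen V ∧ (Prod.map id Subtype.val) ⁻¹' V = U :=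
      (Topology.IsEmbedding.id.prodMap Topology.IsEmbedding.subtypeVal).isOpen_iff.1 hU
    have := (contMDiff_torus_outer (D := D) (p := p) j).continuousOn.isOpen_inter_preimage
      isOpen_slit hV
    convert this using 1
    ext q
    by_cases hq : q.2 = 0
    · simp [torus_of_eq hq, slit, hq]
    · simp [torus_of_ne hq, slit, hq]

theorem isOpenMap_torus (j : J) : IsOpenMap (torus D p j) := by
  intro V hV
  refine isOpen_iff.2 ⟨?_, fun i => ?_⟩
  · have h1 : IsOpen (slit ∩ glueInv (p j) ⁻¹' V) :=
      (contMDiffOn_glueInv (p j)).continuousOn.isOpen_inter_preimage isOpen_slit hV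
    have h2 := (IsOpenMap.id.prodMap (D.isLocalDiffeomorph j).isOpenMap) _ h1
    convert h2.preimage (continuous_id.prodMap continuous_subtype_val) using 1
    ext ⟨l, x⟩
    constructor
    · rintro ⟨q, hq, hqe⟩
      by_cases h0 : q.2 = 0
      · rw [torus_of_eq h0] at hqe; cases hqe
      · rw [torus_of_ne h0, outer.injEq] at hqe
        refine ⟨glue (p j) q, ⟨glue_snd_ne_zero.2 h0, ?_⟩, ?_⟩
        · simpa [glueInv_glue h0] using hq
        · rw [← hqe]; rfl
    · rintro ⟨⟨l', v⟩, ⟨hv, hV'⟩, hqe⟩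
      refine ⟨_, hV', ?_⟩
      rw [torus_of_ne (glueInv_snd_ne_zero.2 hv), outer.injEq]
      simp only [Prod.map_apply, id, Prod.mk.injEq] at hqe
      have hg := glue_glueInv (p := p j) hv
      ext1
      · exact (congrArg Prod.fst hg).trans hqe.1
      · ext1; exact (congrArg (fun q => D.disk j q.2) hg).trans hqe.2
  · by_cases hij : i = j
    · subst hij
      convert hV
      ext q
      constructor
      · rintro ⟨q', hq', h⟩
        rwa [← (torus_eq_torus h).2]
      · exact fun h => ⟨q, h, rfl⟩
    · convert isOpen_empty
      ext q
      simp only [Set.mem_preimage, Set.mem_image, Set.mem_empty_iff_false, iff_false]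
      rintro ⟨q', hq', h⟩
      exact hij (torus_eq_torus h).1.symm

theorem isOpenEmbedding_outer :
    Topology.IsOpenEmbedding (outer : Circle × D.punctured → SeifertManifold D p) :=
  .of_continuous_injective_isOpenMap continuous_outer (fun _ _ h => by simpa using h)
    isOpenMap_outer

theorem isOpenEmbedding_torus (j : J) : Topology.IsOpenEmbedding (torus D p j) :=
  .of_continuous_injective_isOpenMap (continuous_torus j) (fun _ _ h => (torus_eq_torus h).2)
    (isOpenMap_torus j)


/-- The charts coming from the piece `S¹ × (S ∖ centres)`. -/
def outerChart (q : Circle × D.punctured) :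
    OpenPartialHomeomorph (SeifertManifold D p) (ModelProd (EuclideanSpace ℝ (Fin 1)) ℂ) :=
  haveI : Nonempty (Circle × D.punctured) := ⟨q⟩
  (isOpenEmbedding_outer.toOpenPartialHomeomorph outer).symm ≫ₕ chartAt _ q

/-- The charts coming from the surgery tori. -/
def torusChart (j : J) (q : Circle × ℂ) :
    OpenPartialHomeomorph (SeifertManifold D p) (ModelProd (EuclideanSpace ℝ (Fin 1)) ℂ) :=
  ((isOpenEmbedding_torus j).toOpenPartialHomeomorph (torus D p j)).symm ≫ₕ chartAt _ q

/-- The charts of the pieces are the charts of the glued manifold. -/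
instance chartedSpace :
    ChartedSpace (ModelProd (EuclideanSpace ℝ (Fin 1)) ℂ) (SeifertManifold D p) where
  atlas := Set.range outerChart ∪ ⋃ j, Set.range (torusChart j)
  chartAt
    | outer q => outerChart q
    | core j z => torusChart j (z, 0)
  mem_chart_source y := by
    cases y with
    | outer q =>
      have : Nonempty (Circle × D.punctured) := ⟨q⟩
      change outer q ∈ (outerChart q).source
      rw [outerChart, OpenPartialHomeomorph.trans_source]
      refine ⟨by simp, ?_⟩
      have h := (isOpenEmbedding_outer (D := D) (p := p)).toOpenPartialHomeomorph_left_inv outer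
        (x := q)
      simp [h]
    | core j z =>
      change core j z ∈ (torusChart j (z, 0)).source
      rw [torusChart, OpenPartialHomeomorph.trans_source]
      have h0 : core j z = torus D p j (z, 0) := by simp [torus]
      refine ⟨by rw [h0]; simp, ?_⟩
      have h := (isOpenEmbedding_torus (D := D) (p := p) j).toOpenPartialHomeomorph_left_inv _
        (x := (z, 0))
      rw [h0]
      simp [h]
  chart_mem_atlas y := by
    cases y with
    | outer q => exact Or.inl ⟨q, rfl⟩
    | core j z => exact Or.inr (Set.mem_iUnion.2 ⟨j, _, rfl⟩)

end SeifertManifold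

theorem contDiffOn_transition {E H X Y Z : Type*} [NormedAddCommGroup E] [NormedSpace ℝ E]
    [TopologicalSpace H] {I : ModelWithCorners ℝ E H} [TopologicalSpace X] [ChartedSpace H X]
    [IsManifold I ∞ X] [TopologicalSpace Z] [ChartedSpace H Z] [IsManifold I ∞ Z]
    [TopologicalSpace Y] (A : OpenPartialHomeomorph X Y) (B : OpenPartialHomeomorph Z Y)
    (hAB : ContMDiffOn I I ∞ (B.symm ∘ A) (A ≫ₕ B.symm).source) (x : X) (z : Z) :
    ContDiffOn ℝ ∞ (I ∘ ((A.symm ≫ₕ chartAt H x).symm ≫ₕ (B.symm ≫ₕ chartAt H z)) ∘ I.symm)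
      (I.symm ⁻¹' ((A.symm ≫ₕ chartAt H x).symm ≫ₕ (B.symm ≫ₕ chartAt H z)).source ∩
        Set.range I) := by
  rw [← contMDiffOn_iff_contDiffOn]
  have h1 := contMDiffOn_extChartAt_symm (I := I) (n := ∞) x
  have h2 := contMDiffOn_extChartAt (I := I) (n := ∞) (x := z)
  have key : ∀ y ∈ (I.symm ⁻¹' ((A.symm ≫ₕ chartAt H x).symm ≫ₕ (B.symm ≫ₕ chartAt H z)).source ∩
        Set.range I), y ∈ (extChartAt I x).target ∧ (extChartAt I x).symm y ∈ (A ≫ₕ B.symm).source ∧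
        B.symm (A ((extChartAt I x).symm y)) ∈ (chartAt H z).source := by
    rintro y ⟨hy, hr⟩
    simp only [mfld_simps, Set.mem_preimage] at hy
    simp only [mfld_simps]
    tauto
  exact (h2.comp (hAB.comp (h1.mono fun y hy => (key y hy).1) fun y hy => (key y hy).2.1)
    fun y hy => (key y hy).2.2)

namespace SeifertManifold
variable {D : DiskSystem S J} {p : J → ℤ}

theorem contMDiffAt_torusInv (j : J) {l : Circle} {v : ℂ} (hv : v ≠ 0) (x : D.punctured)
    (hx : D.disk j v = x) [Nonempty (Circle × D.punctured)] : ContMDiffAt Model3 Model3 ∞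
      (((isOpenEmbedding_torus (D := D) (p := p) j).toOpenPartialHomeomorph (torus D p j)).symm ∘
        outer) (l, x) := by
  have hloc := D.isLocalDiffeomorph j v
  set ψ := hloc.localInverse
  have h1 : ContMDiffAt Model3 Model3 ∞ (fun q : Circle × D.punctured => (q.1, ψ q.2)) (l, x) := by
    refine contMDiffAt_fst.prodMk ?_
    have h := hloc.localInverse_contMDiffAt
    rw [hx] at h
    exact ContMDiffAt.comp (l, x) h
      (contMDiff_subtype_val.contMDiffAt.comp (l, x) contMDiffAt_snd)
  have hψ : ψ x = v := by
    rw [← hx]; exact hloc.localInverse_left_inv hloc.localInverse_mem_target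
  have h2 : ContMDiffAt Model3 Model3 ∞ (glueInv (p j)) (l, ψ x) := 
    (contMDiffOn_glueInv (p j)).contMDiffAt (isOpen_slit.mem_nhds (by simpa [slit, hψ] using hv))
  refine (ContMDiffAt.comp (l, x) h2 h1).congr_of_eventuallyEq ?_
  have ho : ∀ᶠ q : Circle × D.punctured in 𝓝 (l, x), (q.2 : S) ∈ ψ.source := by
    have : ContinuousAt (fun q : Circle × D.punctured => (q.2 : S)) (l, x) := by fun_prop
    refine this.eventually_mem (ψ.open_source.mem_nhds ?_)
    simpa [← hx] using hloc.localInverse_mem_source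
  have hn : ∀ᶠ q : Circle × D.punctured in 𝓝 (l, x), ψ q.2 ≠ 0 := by
    have := (contMDiff_snd.contMDiffAt.comp _ h1).continuousAt
    refine this.eventually_ne ?_
    simpa [hψ] using hv
  filter_upwards [ho, hn] with q hq hq0
  have h3 : outer q = torus D p j (glueInv (p j) (q.1, ψ q.2)) := by
    have hg := glue_glueInv (p := p j) (q := (q.1, ψ q.2)) hq0
    rw [torus_of_ne (glueInv_snd_ne_zero.2 hq0), outer.injEq]
    ext1
    · exact (congrArg Prod.fst hg).symm
    · ext1
      refine ((congrArg (fun q => D.disk j q.2) hg).trans ?_).symm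
      exact hloc.localInverse_right_inv hq
  simp only [Function.comp_apply]
  rw [h3]
  exact (isOpenEmbedding_torus (D := D) (p := p) j).toOpenPartialHomeomorph_left_inv _


theorem contMDiffOn_outer_torus (j : J) [Nonempty (Circle × D.punctured)] :
    ContMDiffOn Model3 Model3 ∞
      (((isOpenEmbedding_torus (D := D) (p := p) j).toOpenPartialHomeomorph (torus D p j)).symm ∘
        outer) (outer ⁻¹' Set.range (torus D p j)) := by
  rintro ⟨l, x⟩ ⟨q, hq⟩
  by_cases h0 : q.2 = 0
  · rw [torus_of_eq h0] at hq; cases hq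
  · rw [torus_of_ne h0, outer.injEq, Prod.mk.injEq] at hq
    exact (contMDiffAt_torusInv j (glue_snd_ne_zero.2 h0) x
      (congrArg Subtype.val hq.2)).contMDiffWithinAt

theorem contMDiffOn_torus_outer (j : J) [Nonempty (Circle × D.punctured)] :
    ContMDiffOn Model3 Model3 ∞
      (((isOpenEmbedding_outer (D := D) (p := p)).toOpenPartialHomeomorph outer).symm ∘
        torus D p j) (torus D p j ⁻¹' Set.range outer) := by
  set A := ((isOpenEmbedding_outer (D := D) (p := p)).toOpenPartialHomeomorph outer) with hA
  have hs : torus D p j ⁻¹' Set.range outer ⊆ slit := by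
    rintro q ⟨q', hq'⟩ h0
    rw [torus_of_eq h0] at hq'; cases hq'
  have hval : ∀ q ∈ slit, (A.symm (torus D p j q)).1 = (glue (p j) q).1 ∧
      ((A.symm (torus D p j q)).2 : S) = D.disk j (glue (p j) q).2 := by
    intro q hq
    rw [torus_of_ne hq]
    have := (isOpenEmbedding_outer (D := D) (p := p)).toOpenPartialHomeomorph_left_inv outer
      (x := ((glue (p j) q).1,
        ⟨D.disk j (glue (p j) q).2, D.disk_mem_punctured j (glue_snd_ne_zero.2 hq)⟩))
    rw [hA, this]
    exact ⟨rfl, rfl⟩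
  have h := contMDiff_torus_outer (D := D) (p := p) j
  intro q hq
  have hat := h.contMDiffAt (isOpen_slit.mem_nhds (hs hq))
  have hev := isOpen_slit.mem_nhds (hs hq)
  refine ContMDiffAt.contMDiffWithinAt (ContMDiffAt.prodMk
    (f := fun q => (A.symm (torus D p j q)).1) (g := fun q => (A.symm (torus D p j q)).2) ?_ ?_)
  · refine (contMDiffAt_fst.comp q hat).congr_of_eventuallyEq ?_
    filter_upwards [hev] with q' hq'
    exact (hval q' hq').1
  · rw [← ContMDiffAt.subtypeVal_comp_iff]
    refine (contMDiffAt_snd.comp q hat).congr_of_eventuallyEq ?_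
    filter_upwards [hev] with q' hq'
    exact (hval q' hq').2

/-- The glued space is a smooth 3-manifold. -/
instance isManifold [IsManifold 𝓘(ℝ, ℂ) ∞ S] : IsManifold Model3 ∞ (SeifertManifold D p) := by
  refine isManifold_of_contDiffOn _ _ _ ?_
  intro e e' he he'
  rcases he with ⟨q, rfl⟩ | he <;> rcases he' with ⟨q', rfl⟩ | he'
  · have : Nonempty (Circle × D.punctured) := ⟨q⟩
    refine contDiffOn_transition _ _ ?_ q q'
    refine contMDiffOn_id.congr fun x _ => ?_
    exact isOpenEmbedding_outer.toOpenPartialHomeomorph_left_inv _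
  · obtain ⟨j, q', rfl⟩ := Set.mem_iUnion.1 he'
    have : Nonempty (Circle × D.punctured) := ⟨q⟩
    refine contDiffOn_transition _ _ ?_ q q'
    refine (contMDiffOn_outer_torus j).mono fun x hx => ?_
    simpa using hx
  · obtain ⟨j, q, rfl⟩ := Set.mem_iUnion.1 he
    have : Nonempty (Circle × D.punctured) := ⟨q'⟩
    refine contDiffOn_transition _ _ ?_ q q'
    refine (contMDiffOn_torus_outer j).mono fun x hx => ?_
    simpa using hx
  · obtain ⟨j, q, rfl⟩ := Set.mem_iUnion.1 he
    obtain ⟨j', q', rfl⟩ := Set.mem_iUnion.1 he'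
    refine contDiffOn_transition _ _ ?_ q q'
    by_cases hj : j = j'
    · subst hj
      refine contMDiffOn_id.congr fun x _ => ?_
      exact (isOpenEmbedding_torus j).toOpenPartialHomeomorph_left_inv _
    · intro x hx
      exfalso
      have hx' : torus D p j x ∈ Set.range (torus D p j') := by simpa using hx
      obtain ⟨y, hy⟩ := hx'
      exact hj (torus_eq_torus hy).1.symm


theorem separated_of_isOpenEmbedding {X Y : Type*} [TopologicalSpace X] [T2Space X]
    [TopologicalSpace Y] {f : X → Y} (hf : Topology.IsOpenEmbedding f) (a b : X)
    (hab : f a ≠ f b) :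
    ∃ u v, IsOpen u ∧ IsOpen v ∧ f a ∈ u ∧ f b ∈ v ∧ Disjoint u v := by
  obtain ⟨u, v, hu, hv, ha, hb, huv⟩ := t2_separation (fun h => hab (congrArg f h))
  exact ⟨f '' u, f '' v, hf.isOpenMap _ hu, hf.isOpenMap _ hv, ⟨a, ha, rfl⟩, ⟨b, hb, rfl⟩,
    (Set.disjoint_image_iff hf.injective).2 huv⟩

/-- The glued space is Hausdorff. -/
theorem t2 : T2Space (SeifertManifold D p) := by
  have hmix : ∀ (j : J) (z : Circle) (q : Circle × D.punctured),
      ∃ u v : Set (SeifertManifold D p), IsOpen u ∧ IsOpen v ∧ core j z ∈ u ∧ outer q ∈ v ∧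
        Disjoint u v := by
    intro j z q
    by_cases hq : (q.2 : S) ∈ D.disk j '' Metric.closedBall 0 1
    · obtain ⟨v, -, hv⟩ := hq
      have hv0 : v ≠ 0 := by
        rintro rfl
        exact q.2.2 ⟨j, hv⟩
      have h1 : core j z = torus D p j (z, 0) := by simp [torus]
      have hg := glue_glueInv (p := p j) (q := (q.1, v)) hv0
      have h2 : outer q = torus D p j (glueInv (p j) (q.1, v)) := by
        rw [torus_of_ne (glueInv_snd_ne_zero.2 hv0), outer.injEq]
        ext1
        · exact (congrArg Prod.fst hg).symm
        · ext1
          exact ((congrArg (fun q => D.disk j q.2) hg).trans hv).symm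
      rw [h1, h2]
      refine separated_of_isOpenEmbedding (isOpenEmbedding_torus j) _ _ ?_
      rw [← h1, ← h2]
      simp
    · have hc : IsClosed (D.disk j '' Metric.closedBall 0 1) :=
        ((isCompact_closedBall _ _).image (D.isLocalDiffeomorph j).contMDiff.continuous).isClosed
      refine ⟨torus D p j '' {q | ‖q.2‖ < 1},
        outer '' {q | (q.2 : S) ∈ (D.disk j '' Metric.closedBall 0 1)ᶜ},
        isOpenMap_torus j _ (isOpen_lt (by fun_prop) (by fun_prop)),
        isOpenMap_outer _ (hc.isOpen_compl.preimage (by fun_prop)),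
        ⟨(z, 0), by simp, by simp [torus]⟩, ⟨q, hq, rfl⟩, ?_⟩
      rw [Set.disjoint_left]
      rintro _ ⟨a, ha, rfl⟩ ⟨b, hb, hab⟩
      by_cases h0 : a.2 = 0
      · rw [torus_of_eq h0] at hab; cases hab
      · rw [torus_of_ne h0, outer.injEq] at hab
        subst hab
        refine hb ⟨_, ?_, rfl⟩
        have hn : ‖(glue (p j) a).2‖ = ‖a.2‖ := by
          simp only [glue, norm_mul, Circle.norm_coe, mul_one, Complex.norm_real, norm_norm]
        simpa [hn] using (le_of_lt ha)
  constructor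
  intro y y' hne
  cases y with
  | outer q =>
    cases y' with
    | outer q' => exact separated_of_isOpenEmbedding isOpenEmbedding_outer _ _ hne
    | core j z =>
      obtain ⟨u, v, hu, hv, h1, h2, h3⟩ := hmix j z q
      exact ⟨v, u, hv, hu, h2, h1, h3.symm⟩
  | core j z =>
    cases y' with
    | outer q => exact hmix j z q
    | core j' z' =>
      have h1 : core j z = torus D p j (z, 0) := by simp [torus]
      have h2 : core j' z' = torus D p j' (z', 0) := by simp [torus]
      by_cases hj : j = j'
      · subst hj
        rw [h1, h2] at hne ⊢
        exact separated_of_isOpenEmbedding (isOpenEmbedding_torus j) _ _ hne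
      · refine ⟨Set.range (torus D p j), Set.range (torus D p j'),
          (isOpenEmbedding_torus j).isOpen_range, (isOpenEmbedding_torus j').isOpen_range,
          ⟨_, h1.symm⟩, ⟨_, h2.symm⟩, ?_⟩
        rw [Set.disjoint_left]
        rintro _ ⟨a, rfl⟩ ⟨b, hb⟩
        exact hj (torus_eq_torus hb).1.symm

/-- The glued space is compact if the surface is. -/
theorem compact [CompactSpace S] : CompactSpace (SeifertManifold D p) := by
  have hK : IsCompact {x : D.punctured | ∀ j, (x : S) ∉ D.disk j '' Metric.ball 0 1} := by
    rw [Topology.IsEmbedding.subtypeVal.isCompact_iff]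
    have hc : IsClosed (⋃ j, D.disk j '' Metric.ball 0 1)ᶜ :=
      (isOpen_iUnion fun j => (D.isLocalDiffeomorph j).isOpenMap _ Metric.isOpen_ball).isClosed_compl
    convert hc.isCompact using 1
    ext x
    constructor
    · rintro ⟨x, hx, rfl⟩
      simpa using hx
    · intro hx
      have hx' : ∀ j, x ∉ D.disk j '' Metric.ball 0 1 := by simpa using hx
      refine ⟨⟨x, ?_⟩, hx', rfl⟩
      rintro ⟨j, hj⟩
      exact hx' j ⟨0, by simp, hj⟩
  constructor
  have h1 := (isCompact_univ (X := Circle)).prod hK |>.image (continuous_outer (D := D) (p := p))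
  have h2 : IsCompact (⋃ j, torus D p j '' (Set.univ ×ˢ Metric.closedBall 0 1)) :=
    isCompact_iUnion fun j =>
      ((isCompact_univ.prod (isCompact_closedBall _ _)).image (continuous_torus j))
  convert h1.union h2
  symm
  rw [Set.eq_univ_iff_forall]
  intro y
  cases y with
  | core j z => exact Or.inr (Set.mem_iUnion.2 ⟨j, (z, 0), by simp, by simp [torus]⟩)
  | outer q =>
    by_cases h : ∀ j, (q.2 : S) ∉ D.disk j '' Metric.ball 0 1
    · exact Or.inl ⟨q, by simpa using h, rfl⟩
    · push Not at h
      obtain ⟨j, v, hv, hq⟩ := h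
      have hv0 : v ≠ 0 := by
        rintro rfl
        exact q.2.2 ⟨j, hq⟩
      have hg := glue_glueInv (p := p j) (q := (q.1, v)) hv0
      refine Or.inr (Set.mem_iUnion.2 ⟨j, glueInv (p j) (q.1, v), ⟨trivial, ?_⟩, ?_⟩)
      · have hn : ‖(glueInv (p j) (q.1, v)).2‖ = ‖v‖ := by
          simp only [glueInv, norm_mul, Circle.norm_coe, mul_one, Complex.norm_real, norm_norm]
        rw [mem_closedBall_zero_iff, hn]
        exact (mem_ball_zero_iff.1 hv).le
      · rw [torus_of_ne (glueInv_snd_ne_zero.2 hv0), outer.injEq]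
        have hg1 : (glue (p j) (glueInv (p j) (q.1, v))).1 = q.1 := congrArg Prod.fst hg
        exact Prod.ext hg1
          (Subtype.ext ((congrArg (fun q => D.disk j q.2) hg).trans hq))

/-- The Seifert fibration, as the flow whose orbits are the (oriented) fibres. On
`S¹ × (S ∖ centres)` the fibres are the circles of the first factor; the core of the `j`-th surgery
torus is a fibre of multiplicity `p j`. -/
def fiberCurve : SeifertManifold D p → ℝ → SeifertManifold D p
  | outer q, t => outer (Circle.exp t * q.1, q.2)
  | core j z, t => core j (Circle.exp (p j * t) * z)

theorem fiberCurve_zero (y : SeifertManifold D p) : fiberCurve y 0 = y := by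
  cases y <;> simp [fiberCurve]

/-- In the surgery torus the fibres are the curves `p λ - (p² - 1) μ` on the concentric tori. -/
theorem fiberCurve_torus (j : J) (z : Circle) (w : ℂ) (t : ℝ) :
    fiberCurve (torus D p j (z, w)) t =
      torus D p j (Circle.exp (p j * t) * z, (Circle.exp (-((p j : ℝ) ^ 2 - 1) * t) : ℂ) * w) := by
  by_cases h : w = 0
  · rw [torus_of_eq h, torus_of_eq (by simp [h])]; rfl
  · have hw : 0 < ‖w‖ := by simpa using h
    have he (a b : ℝ) (m : ℤ) (hab : m * a = b) : Circle.exp a ^ m = Circle.exp b := by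
      rw [← hab, ← Circle.exp_zsmul]
      simp
    have hph (c : Circle) : phase (c * w) = c * phase w := by
      rw [show (c : ℂ) * w = (‖w‖ : ℂ) * ((c * phase w : Circle) : ℂ) by
        conv_lhs => rw [← norm_mul_phase w]
        rw [Circle.coe_mul]; ring]
      exact phase_mul_coe hw _
    rw [torus_of_ne h, torus_of_ne (by simpa using h)]
    simp only [fiberCurve, outer.injEq]
    have e : glue (p j) (Circle.exp (p j * t) * z, (Circle.exp (-((p j : ℝ) ^ 2 - 1) * t) : ℂ) * w)
        = (Circle.exp t * (glue (p j) (z, w)).1, (glue (p j) (z, w)).2) := by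
      simp only [glue, hph, norm_mul, Circle.norm_coe, one_mul]
      ext1
      · simp only [mul_zpow]
        rw [he _ ((p j : ℝ) * p j * t) (p j) (by ring), mul_mul_mul_comm, ← Circle.exp_add]
        congr 2; ring
      · simp only [mul_zpow]
        rw [he _ (-((p j : ℝ) ^ 2 - 1) * t * p j) (p j) (by ring),
          he _ (((p j : ℝ) ^ 2 - 1) * t * p j) (p j ^ 2 - 1) (by push_cast; ring),
          mul_mul_mul_comm, ← Circle.exp_add]
        have : -((p j : ℝ) ^ 2 - 1) * t * p j + ((p j : ℝ) ^ 2 - 1) * t * p j = 0 := by ring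
        rw [this]; simp
    ext1
    · exact (congrArg Prod.fst e).symm
    · ext1; exact (congrArg (fun q => D.disk j q.2) e).symm


/-- Velocity at time `0` of a curve in the glued manifold. -/
def velocity (c : ℝ → SeifertManifold D p) : TangentSpace Model3 (c 0) :=
  mfderiv 𝓘(ℝ, ℝ) Model3 c 0 (1 : ℝ)

/-- The vector at `y` tangent to the oriented Seifert fibre through `y`
(recall `fiberCurve y 0 = y`). -/
def fiberVector (y : SeifertManifold D p) : TangentSpace Model3 y :=
  velocity (fiberCurve y)

variable (D p) in
/-- The binding of the open book is the union of the core circles of the surgery tori. This is its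
tangent vector at a point of the `j`-th core, pointing in the direction of `λ`. This is the
orientation as boundary of the pages: near the core a page is an annulus on which the boundary
orientation of the missing point of `S` is `-m = λ - p μ`. -/
def bindingVector (j : J) (z : Circle) :
    TangentSpace Model3 (core j z : SeifertManifold D p) :=
  velocity (fun t => (core j (Circle.exp t * z) : SeifertManifold D p))

variable (D p) in
/-- The complement of the binding is `S¹ × (S ∖ centres)`, and the open book fibration on it is the
projection to `S¹`. The page over `l` is parametrised by this map and oriented by `S`. In a surgery
torus it is the annulus `phase w * z ^ p = l`, whose leaf on each concentric torus is a curve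
`p μ - λ` and whose inner boundary is the core. -/
def page (l : Circle) (x : D.punctured) : SeifertManifold D p := outer (l, x)

variable (D p) in
/-- The meridian disc of the `j`-th surgery torus through the point `z` of its core. -/
def meridianDisk (j : J) (z : Circle) (w : ℂ) : SeifertManifold D p := torus D p j (z, w)

/-- A positively oriented basis of the tangent space at `y`: off the binding, the fibre
direction followed by a positive basis of the page `{l} × (S ∖ centres)`; on the binding, the core
direction followed by a positive basis of the meridian disc. (The orientation is that of `S¹ × S`,
extended over the surgery tori, which are oriented as `S¹ × D²`.) -/
def positiveFrame : (y : SeifertManifold D p) → Fin 3 → TangentSpace Model3 y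
  | outer (l, x) => ![fiberVector (outer (l, x)),
      mfderiv 𝓘(ℝ, ℂ) Model3 (page D p l) x (1 : ℂ),
      mfderiv 𝓘(ℝ, ℂ) Model3 (page D p l) x Complex.I]
  | core j z => ![bindingVector D p j z,
      mfderiv 𝓘(ℝ, ℂ) Model3 (meridianDisk D p j z) 0 (1 : ℂ),
      mfderiv 𝓘(ℝ, ℂ) Model3 (meridianDisk D p j z) 0 Complex.I]

end SeifertManifold

end

/-! ### One-forms and their exterior derivative (manifolds without boundary) -/

section Forms

variable {E H : Type*} [NormedAddCommGroup E] [NormedSpace ℝ E] [TopologicalSpace H]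
  (I : ModelWithCorners ℝ E H) (M : Type*) [TopologicalSpace M] [ChartedSpace H M]

/-- A (not necessarily smooth) 1-form on `M`. -/
abbrev OneForm := ∀ y : M, TangentSpace I y →L[ℝ] ℝ

variable {I M}

/-- The 1-form on the model space that represents `α` in the chart at `y`: the pullback of `α`
under the inverse of the chart. -/
def OneForm.inChart (α : OneForm I M) (y : M) (e : E) : E →L[ℝ] ℝ :=
  (α ((extChartAt I y).symm e)).comp (mfderiv 𝓘(ℝ, E) I (extChartAt I y).symm e)

/-- Smoothness of a 1-form: the representatives in the charts are smooth. -/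
def OneForm.IsSmooth (α : OneForm I M) : Prop :=
  ∀ y : M, ContDiffOn ℝ ∞ (α.inChart y) (extChartAt I y).target

/-- The family `α t`, `0 ≤ t ≤ 1`, of 1-forms is smooth jointly in `t` and the point. -/
def OneForm.IsSmoothFamily (α : ℝ → OneForm I M) : Prop :=
  ∀ y : M, ContDiffOn ℝ ∞ (fun q : ℝ × E => (α q.1).inChart y q.2)
    (Set.Icc 0 1 ×ˢ (extChartAt I y).target)

/-- The exterior derivative `dα` at `y`, computed in the chart at `y` by
`da (u, v) = (D_u a) v - (D_v a) u`. -/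
def OneForm.d (α : OneForm I M) (y : M) (u v : TangentSpace I y) : ℝ :=
  let φ : TangentSpace I y →L[ℝ] E := mfderiv I 𝓘(ℝ, E) (extChartAt I y) y
  let D : E →L[ℝ] E →L[ℝ] ℝ := fderiv ℝ (α.inChart y) (extChartAt I y y)
  D (φ u) (φ v) - D (φ v) (φ u)

/-- The 3-form `α ∧ dα` at `y`. -/
def OneForm.wedgeD (α : OneForm I M) (y : M) (u v w : TangentSpace I y) : ℝ :=
  α y u * α.d y v w + α y v * α.d y w u + α y w * α.d y u v

variable (I M) in
/-- A cooriented field of planes: at each point `y` a subspace of the tangent space together with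
the set of vectors on its positive side. -/
structure CoorientedPlaneField where
  plane : ∀ y : M, Submodule ℝ (TangentSpace I y)
  positiveSide : ∀ y : M, Set (TangentSpace I y)

/-- `ξ = ker α`, cooriented by `α`. -/
def CoorientedPlaneField.IsKernel (ξ : CoorientedPlaneField I M) (α : OneForm I M) : Prop :=
  ∀ (y : M) (v : TangentSpace I y),
    (v ∈ ξ.plane y ↔ α y v = 0) ∧ (v ∈ ξ.positiveSide y ↔ 0 < α y v)

end Forms

/-! ### Contact structures, compatibility with the open book, horizontality -/

section Contact

variable {S : Type*} [TopologicalSpace S] [T2Space S] [ChartedSpace ℂ S]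
  {J : Type*} [Finite J] {D : DiskSystem S J} {p : J → ℤ}

open SeifertManifold

/-- `α` is a positive contact form: it is smooth and `α ∧ dα > 0`. -/
def IsContactForm (α : OneForm Model3 (SeifertManifold D p)) : Prop :=
  α.IsSmooth ∧ ∀ y, 0 < α.wedgeD y (positiveFrame y 0) (positiveFrame y 1) (positiveFrame y 2)

/-- `ξ` is a (cooriented, positive) contact structure compatible with the open book: it is the
kernel of a contact form `α` with `α > 0` on the oriented binding and `dα > 0` on every page. -/
def IsCompatible (ξ : CoorientedPlaneField Model3 (SeifertManifold D p)) : Prop :=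
  ∃ α : OneForm Model3 (SeifertManifold D p), IsContactForm α ∧ ξ.IsKernel α ∧
    (∀ j z, 0 < α (core j z) (bindingVector D p j z)) ∧
    ∀ l x, 0 < α.d (page D p l x) (mfderiv 𝓘(ℝ, ℂ) Model3 (page D p l) x (1 : ℂ))
      (mfderiv 𝓘(ℝ, ℂ) Model3 (page D p l) x Complex.I)

/-- `ξ` and `ξ'` are isotopic contact structures: they are the ends of a smooth family of contact
structures (kernels of contact forms). -/
def ContactIsotopic (ξ ξ' : CoorientedPlaneField Model3 (SeifertManifold D p)) : Prop :=
  ∃ α : ℝ → OneForm Model3 (SeifertManifold D p), OneForm.IsSmoothFamily α ∧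
    (∀ t ∈ Set.Icc (0 : ℝ) 1, IsContactForm (α t)) ∧ ξ.IsKernel (α 0) ∧ ξ'.IsKernel (α 1)

/-- `ξ` is horizontal: it is positively transverse to the Seifert fibres. -/
def IsHorizontal (ξ : CoorientedPlaneField Model3 (SeifertManifold D p)) : Prop :=
  ∀ y, fiberVector y ∉ ξ.plane y ∧ fiberVector y ∈ ξ.positiveSide y

end Contact

/-- The surgery coefficients that produce the Seifert invariants `(g, n; r₁, …, r_k)` with `n ≤ 0`:
`+1` on `|n|` fibres and `-1 / r_i` (an integer in the case of interest) on `k` further fibres. -/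
def surgeryCoefficient (n : ℤ) {k : ℕ} (r : Fin k → ℚ) : Fin n.natAbs ⊕ Fin k → ℤ :=
  Sum.elim (fun _ => 1) (fun i => ⌊-1 / r i⌋)

end SeifertOpenBook

end

/-!
Off the binding let `dθ` be the pullback of the angle form under the open book fibration, and let
`r ≥ 0` be a function on the manifold that does not depend on `θ`, equal to a multiple of the
distance to the binding near the binding, nondecreasing in that distance, and equal
to `1` outside a small neighbourhood of the binding. If `α` is a contact form compatible with the
open book, then so is `α + c r² dθ` for every `c ≥ 0`, and for large `c` it is positive on the Seifert
fibres. Hence `t ↦ α + t c r² dθ` is the isotopy that is wanted; uniqueness of the compatible contact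
structure is not needed.

The form `β = r² dθ` is smooth across the binding because it is the pullback (`angularForm`) of
`x dy - y dx` under the smooth map `r exp (i θ)` to the plane (`openBookMap`), which is a multiple of
`w z ^ p` near a core. For the same reason `β ∧ dβ = 0`, so that the change of `α ∧ dα` is linear in
`c` (`wedgeD_add_smul_angularForm`), with coefficient `β ∧ dα + α ∧ dβ`. Here `β ∧ dα ≥ 0` since `dα`
is positive on the pages. And `α ∧ dβ = 2 r α ∧ dr ∧ dθ ≥ 0`: this vanishes where `r` is constant,
and near the binding its sign is that of `α` on the field `λ - p μ`, which is tangent to the pages and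
to the concentric tori, and on which `α` is positive near the binding, as it is so on the binding
(`wedge_dradius_nonneg`, `isContactForm_add_smul_angularForm`). On the pages `dβ` is zero, and on the
binding `β` is zero, so that compatibility is kept.

Finally `β` is `r²` on the fibre direction. Near the binding `α` is itself positive on the fibres,
because on the core the fibre direction is `p λ` with `p > 0` (`exists_pos_near_core`); elsewhere
`r = 1`, and compactness bounds `α` from below on the fibres (`exists_bound_onVelocity_fiberCurve`).
-/

open scoped Manifold ContDiff Topology

noncomputable section

namespace SeifertOpenBook

open TopologicalSpace

set_option linter.unusedSectionVars false

/-! ### One-forms pulled back from the plane -/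

section AngularForm

variable {E H : Type*} [NormedAddCommGroup E] [NormedSpace ℝ E] [TopologicalSpace H]
  {I : ModelWithCorners ℝ E H} {M : Type*} [TopologicalSpace M] [ChartedSpace H M]

/-- The area form `(x, y) ↦ Im (x̄ y)` of the plane. -/
def areaForm : ℂ →L[ℝ] ℂ →L[ℝ] ℝ :=
  (ContinuousLinearMap.compL ℝ ℂ ℂ ℝ Complex.imCLM).comp
    ((ContinuousLinearMap.mul ℝ ℂ).comp (Complex.conjCLE : ℂ →L[ℝ] ℂ))

theorem areaForm_apply (x y : ℂ) : areaForm x y = x.re * y.im - x.im * y.re := by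
  simp [areaForm]; ring

/-- The plane has no nonzero alternating 3-forms. -/
theorem areaForm_cyclic (x a b c : ℂ) :
    areaForm x a * areaForm b c + areaForm x b * areaForm c a + areaForm x c * areaForm a b = 0 := by
  simp only [areaForm_apply]; ring

variable (I) in
/-- The pullback of `x dy - y dx = r² dθ` under a map `F` to the plane. -/
def angularForm (F : M → ℂ) : OneForm I M := fun y =>
  (areaForm (F y)).comp (mfderiv I 𝓘(ℝ, ℂ) F y)

theorem angularForm_apply (F : M → ℂ) (y : M) (v : TangentSpace I y) :
    angularForm I F y v = areaForm (F y) (mfderiv I 𝓘(ℝ, ℂ) F y v) := rfl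

theorem OneForm.congr_point (α : OneForm I M) {y y' : M} (h : y = y') (v : E) :
    α y v = α y' v := by subst h; rfl

variable [IsManifold I ∞ M] [I.Boundaryless]

theorem mdifferentiableAt_extChartAt_symm_of_mem (y : M) {e : E} (he : e ∈ (extChartAt I y).target) :
    MDifferentiableAt 𝓘(ℝ, E) I (extChartAt I y).symm e :=
  ((contMDiffOn_extChartAt_symm (I := I) (n := ∞) y).contMDiffAt
    ((isOpen_extChartAt_target y).mem_nhds he)).mdifferentiableAt (by simp)

theorem contDiffOn_comp_extChartAt_symm {F : M → ℂ} (hF : ContMDiff I 𝓘(ℝ, ℂ) ∞ F) (y : M) :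
    ContDiffOn ℝ ∞ (F ∘ (extChartAt I y).symm) (extChartAt I y).target :=
  contMDiffOn_iff_contDiffOn.1 (hF.comp_contMDiffOn (contMDiffOn_extChartAt_symm y))

theorem inChart_angularForm {F : M → ℂ} (hF : ContMDiff I 𝓘(ℝ, ℂ) ∞ F) (y : M) {e : E}
    (he : e ∈ (extChartAt I y).target) :
    (angularForm I F).inChart y e = (areaForm ((F ∘ (extChartAt I y).symm) e)).comp
      (fderiv ℝ (F ∘ (extChartAt I y).symm) e) := by
  rw [← mfderiv_eq_fderiv, mfderiv_comp e (hF.mdifferentiableAt (by simp))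
    (mdifferentiableAt_extChartAt_symm_of_mem y he)]
  rfl

theorem contDiffOn_inChart_angularForm {F : M → ℂ} (hF : ContMDiff I 𝓘(ℝ, ℂ) ∞ F) (y : M) :
    ContDiffOn ℝ ∞ ((angularForm I F).inChart y) (extChartAt I y).target := by
  have hf := contDiffOn_comp_extChartAt_symm hF y
  refine ContDiffOn.congr ?_ fun e he => inChart_angularForm hF y he
  exact (areaForm.contDiff.comp_contDiffOn hf).clm_comp
    (hf.fderiv_of_isOpen (isOpen_extChartAt_target y) (by simp))

/-- Adding a multiple of the pullback of `x dy - y dx` under `F` to a 1-form adds the same multiple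
of the pullback of `2 dx ∧ dy` to its exterior derivative. -/
theorem d_add_smul_angularForm {α : OneForm I M} (hα : α.IsSmooth) {F : M → ℂ}
    (hF : ContMDiff I 𝓘(ℝ, ℂ) ∞ F) (c : ℝ) (y : M) (u v : TangentSpace I y) :
    OneForm.d (α + c • angularForm I F) y u v = α.d y u v +
      c * (2 * areaForm (mfderiv I 𝓘(ℝ, ℂ) F y u) (mfderiv I 𝓘(ℝ, ℂ) F y v)) := by
  have ht : (extChartAt I y).target ∈ 𝓝 (extChartAt I y y) := extChartAt_target_mem_nhds y
  have hα' : DifferentiableAt ℝ (α.inChart y) (extChartAt I y y) :=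
    ((hα y).contDiffAt ht).differentiableAt (by simp)
  set f := F ∘ (extChartAt I y).symm with hf
  have hfs : ContDiffAt ℝ ∞ f (extChartAt I y y) :=
    (contDiffOn_comp_extChartAt_symm hF y).contDiffAt ht
  have hf1 : HasFDerivAt f (fderiv ℝ f (extChartAt I y y)) (extChartAt I y y) :=
    (hfs.differentiableAt (by simp)).hasFDerivAt
  have hf2 : HasFDerivAt (fderiv ℝ f) (fderiv ℝ (fderiv ℝ f) (extChartAt I y y))
      (extChartAt I y y) :=
    ((hfs.fderiv_right (m := ∞) (by simp)).differentiableAt (by simp)).hasFDerivAt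
  have hβ : HasFDerivAt ((angularForm I F).inChart y) _ (extChartAt I y y) :=
    ((areaForm.hasFDerivAt.comp _ hf1).clm_comp hf2).congr_of_eventuallyEq
      (Filter.eventually_of_mem ht fun e he => inChart_angularForm hF y he)
  have hsum : HasFDerivAt (OneForm.inChart (α + c • angularForm I F) y) _ (extChartAt I y y) :=
    hα'.hasFDerivAt.add (hβ.const_smul c)
  have hsymm : IsSymmSndFDerivAt ℝ f (extChartAt I y y) :=
    hfs.isSymmSndFDerivAt (by
      rw [minSmoothness_of_isRCLikeNormedField]; exact WithTop.coe_le_coe.2 le_top)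
  have hφ : ∀ w : TangentSpace I y, fderiv ℝ f (extChartAt I y y)
      (mfderiv I 𝓘(ℝ, E) (extChartAt I y) y w) = mfderiv I 𝓘(ℝ, ℂ) F y w := by
    intro w
    have h1 : F =ᶠ[𝓝 y] f ∘ extChartAt I y := by
      filter_upwards [extChartAt_source_mem_nhds (I := I) y] with x hx
      exact (congrArg F ((extChartAt I y).left_inv hx)).symm
    rw [h1.mfderiv_eq, mfderiv_comp y (I' := 𝓘(ℝ, E))
      (hfs.differentiableAt (by simp)).mdifferentiableAt
      (mdifferentiableAt_extChartAt (mem_chart_source H y)), mfderiv_eq_fderiv]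
    rfl
  have key : ∀ a b : E, fderiv ℝ (OneForm.inChart (α + c • angularForm I F) y) (extChartAt I y y) a b
      - fderiv ℝ (OneForm.inChart (α + c • angularForm I F) y) (extChartAt I y y) b a =
      fderiv ℝ (α.inChart y) (extChartAt I y y) a b - fderiv ℝ (α.inChart y) (extChartAt I y y) b a
      + c * (2 * areaForm (fderiv ℝ f (extChartAt I y y) a) (fderiv ℝ f (extChartAt I y y) b)) := by
    intro a b
    -- The second derivative of `f` is symmetric and drops out of the antisymmetrisation.
    have hs := hsymm a b
    rw [hsum.fderiv]
    simp only [add_apply, smul_apply,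
      ContinuousLinearMap.comp_apply, ContinuousLinearMap.compL_apply,
      ContinuousLinearMap.flip_apply, smul_eq_mul, hs, areaForm_apply]
    ring
  rw [← hφ u, ← hφ v]
  exact key _ _

theorem isSmooth_add_smul_angularForm {α : OneForm I M} (hα : α.IsSmooth) {F : M → ℂ}
    (hF : ContMDiff I 𝓘(ℝ, ℂ) ∞ F) (c : ℝ) : OneForm.IsSmooth (α + c • angularForm I F) :=
  fun y => (hα y).add ((contDiffOn_inChart_angularForm hF y).const_smul c)

theorem isSmoothFamily_add_smul_angularForm {α : OneForm I M} (hα : α.IsSmooth) {F : M → ℂ}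
    (hF : ContMDiff I 𝓘(ℝ, ℂ) ∞ F) (c : ℝ) :
    OneForm.IsSmoothFamily fun t => α + (t * c) • angularForm I F := by
  intro y
  have hmaps : Set.MapsTo Prod.snd (Set.Icc (0 : ℝ) 1 ×ˢ (extChartAt I y).target)
      (extChartAt I y).target := fun q hq => hq.2
  exact ((hα y).comp contDiffOn_snd hmaps).add
    ((contDiffOn_fst.mul contDiffOn_const).smul
      ((contDiffOn_inChart_angularForm hF y).comp contDiffOn_snd hmaps))

/-- The change of `α ∧ dα` when a multiple of `β = F^* (x dy - y dx)` is added to `α`. There is no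
quadratic term because `β ∧ dβ` is pulled back from a 3-form on the plane. -/
theorem wedgeD_add_smul_angularForm {α : OneForm I M} (hα : α.IsSmooth) {F : M → ℂ}
    (hF : ContMDiff I 𝓘(ℝ, ℂ) ∞ F) (c : ℝ) (y : M) (u v w : TangentSpace I y) :
    OneForm.wedgeD (α + c • angularForm I F) y u v w = α.wedgeD y u v w + c *
      ((angularForm I F y u * α.d y v w + angularForm I F y v * α.d y w u
          + angularForm I F y w * α.d y u v) +
        2 * (α y u * areaForm (mfderiv I 𝓘(ℝ, ℂ) F y v) (mfderiv I 𝓘(ℝ, ℂ) F y w)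
          + α y v * areaForm (mfderiv I 𝓘(ℝ, ℂ) F y w) (mfderiv I 𝓘(ℝ, ℂ) F y u)
          + α y w * areaForm (mfderiv I 𝓘(ℝ, ℂ) F y u) (mfderiv I 𝓘(ℝ, ℂ) F y v))) := by
  have hadd : ∀ x : TangentSpace I y, (α + c • angularForm I F) y x
      = α y x + c * angularForm I F y x := fun x => rfl
  simp only [OneForm.wedgeD, d_add_smul_angularForm hα hF, hadd, angularForm_apply]
  linear_combination (2 * c ^ 2) * areaForm_cyclic (F y) (mfderiv I 𝓘(ℝ, ℂ) F y u)
    (mfderiv I 𝓘(ℝ, ℂ) F y v) (mfderiv I 𝓘(ℝ, ℂ) F y w)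

/-- A smooth 1-form is continuous along a smooth map from a vector space. -/
theorem OneForm.IsSmooth.continuousAt_comp_mfderiv {α : OneForm I M} (hα : α.IsSmooth)
    {V : Type*} [NormedAddCommGroup V] [NormedSpace ℝ V] {T : V → M} {x : V}
    (hT : ContMDiffAt 𝓘(ℝ, V) I ∞ T x) {ν : V → V} (hν : ContinuousAt ν x) :
    ContinuousAt (fun x' => α (T x') (mfderiv 𝓘(ℝ, V) I T x' (ν x'))) x := by
  set χ := extChartAt I (T x)
  have ht : χ.target ∈ 𝓝 (χ (T x)) := extChartAt_target_mem_nhds _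
  have hχT : ContDiffAt ℝ ∞ (χ ∘ T) x := by
    rw [← contMDiffAt_iff_contDiffAt]
    exact contMDiffAt_extChartAt.comp x hT
  have h1 : ContinuousAt (fun x' => α.inChart (T x) ((χ ∘ T) x') (fderiv ℝ (χ ∘ T) x' (ν x'))) x := by
    have ha : ContinuousAt (α.inChart (T x)) ((χ ∘ T) x) :=
      ((hα (T x)).contDiffAt ht).continuousAt
    have hb : ContinuousAt (fun x' => α.inChart (T x) ((χ ∘ T) x')) x :=
      ContinuousAt.comp (f := χ ∘ T) ha hχT.continuousAt
    exact hb.clm_apply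
      ((hχT.fderiv_right (m := 0) (by simp)).continuousAt.clm_apply hν)
  refine h1.congr ?_
  have hs : ∀ᶠ x' in 𝓝 x, T x' ∈ χ.source :=
    hT.continuousAt.eventually_mem (extChartAt_source_mem_nhds _)
  have hT1 : ∀ᶠ x' in 𝓝 x, ContMDiffAt 𝓘(ℝ, V) I 1 T x' :=
    (contMDiffAt_iff_contMDiffAt_nhds (by simp)).1 (hT.of_le (by simp))
  filter_upwards [hs, hT1, hs.eventually_nhds] with x' hx' hTx' hnx'
  have hd : MDifferentiableAt 𝓘(ℝ, V) I T x' := hTx'.mdifferentiableAt (by simp)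
  have hdχ : MDifferentiableAt I 𝓘(ℝ, E) χ (T x') :=
    mdifferentiableAt_extChartAt (by simpa [χ] using hx')
  have heq : T =ᶠ[𝓝 x'] χ.symm ∘ (χ ∘ T) := by
    filter_upwards [hnx'] with a ha
    simp [χ.left_inv ha]
  have hl : χ.symm ((χ ∘ T) x') = T x' := χ.left_inv hx'
  have hdT : mfderiv 𝓘(ℝ, V) I T x' (ν x') =
      mfderiv 𝓘(ℝ, E) I χ.symm ((χ ∘ T) x') (fderiv ℝ (χ ∘ T) x' (ν x')) := by
    rw [heq.mfderiv_eq, mfderiv_comp x' (I' := 𝓘(ℝ, E))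
      (mdifferentiableAt_extChartAt_symm_of_mem _ (χ.map_source hx')) (hdχ.comp x' hd), mfderiv_eq_fderiv]
    rfl
  rw [hdT]
  exact α.congr_point hl _

end AngularForm

/-! ### The open book map to the plane -/

/-- A nondecreasing cut-off `[0, ∞) → [0, 1]`, smooth on `(0, ∞)`, which is `√(s / b)` for
`s ≤ b / 2` and `1` for `b ≤ s`. It is applied to the square `s` of the distance from the centre of a
disc, so that it is linear in the distance near the centre. -/
def profile (b s : ℝ) : ℝ := 1 - (1 - Real.smoothTransition (2 * s / b - 1)) * (1 - √(s / b))

section Profile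

variable {b : ℝ}

theorem profile_of_le_half (hb : 0 < b) {s : ℝ} (hs : s ≤ b / 2) : profile b s = √(s / b) := by
  rw [profile, Real.smoothTransition.zero_of_nonpos]
  · ring
  · rw [sub_nonpos, div_le_one hb]; linarith

theorem profile_of_ge (hb : 0 < b) {s : ℝ} (hs : b ≤ s) : profile b s = 1 := by
  rw [profile, Real.smoothTransition.one_of_one_le]
  · ring
  · rw [le_sub_iff_add_le, le_div_iff₀ hb]; linarith

theorem profile_monotone (hb : 0 < b) : Monotone (profile b) := by
  intro s t hst
  rcases le_total b t with ht | ht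
  · rw [profile_of_ge hb ht]
    rcases le_total b s with hs | hs
    · rw [profile_of_ge hb hs]
    · have h1 : √(s / b) ≤ 1 := Real.sqrt_le_one.2 ((div_le_one hb).2 hs)
      have := mul_nonneg (sub_nonneg.2 (Real.smoothTransition.le_one (2 * s / b - 1)))
        (sub_nonneg.2 h1)
      rw [profile]; linarith
  · have h1 : √(t / b) ≤ 1 := Real.sqrt_le_one.2 ((div_le_one hb).2 ht)
    have h2 : √(s / b) ≤ √(t / b) := Real.sqrt_le_sqrt (by gcongr)
    have h3 : Real.smoothTransition (2 * s / b - 1) ≤ Real.smoothTransition (2 * t / b - 1) :=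
      Real.smoothTransition.monotone (by gcongr)
    have h4 := Real.smoothTransition.le_one (2 * s / b - 1)
    exact sub_le_sub_left (mul_le_mul (by linarith) (by linarith) (by linarith) (by linarith)) _

theorem profile_nonneg (hb : 0 < b) {s : ℝ} (hs : 0 ≤ s) : 0 ≤ profile b s := by
  have h := profile_monotone hb hs
  rwa [profile_of_le_half hb (s := 0) (by linarith), zero_div, Real.sqrt_zero] at h

theorem contDiffAt_profile (hb : 0 < b) {s : ℝ} (hs : 0 < s) : ContDiffAt ℝ ∞ (profile b) s := by
  have h1 : ContDiffAt ℝ ∞ (fun s : ℝ => 2 * s / b - 1) s := by fun_prop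
  have h2 : ContDiffAt ℝ ∞ (fun s : ℝ => √(s / b)) s :=
    ContDiffAt.sqrt (by fun_prop) (div_pos hs hb).ne'
  exact contDiffAt_const.sub ((contDiffAt_const.sub
    (Real.smoothTransition.contDiffAt.comp s h1)).mul (contDiffAt_const.sub h2))

end Profile

section OpenEmbedding

variable {E H X M : Type*} [NormedAddCommGroup E] [NormedSpace ℝ E]
    [TopologicalSpace H] {I : ModelWithCorners ℝ E H} [TopologicalSpace X] [ChartedSpace H X]
    [IsManifold I ∞ X] [TopologicalSpace M] [ChartedSpace H M] {f : X → M}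

/-- An open embedding is smooth if the charts of its source are charts of its target. -/
theorem contMDiffAt_of_chart_mem [Nonempty X] (hf : Topology.IsOpenEmbedding f) (x : X)
    (h : (hf.toOpenPartialHomeomorph f).symm ≫ₕ chartAt H x ∈ IsManifold.maximalAtlas I ∞ M) :
    ContMDiffAt I I ∞ f x := by
  set c := (hf.toOpenPartialHomeomorph f).symm ≫ₕ chartAt H x with hc
  have hx : x ∈ (chartAt H x).source := mem_chart_source H x
  have h1 : chartAt H x x ∈ c.target := by simp [hc]
  refine ((contMDiffAt_symm_of_mem_maximalAtlas h h1).comp x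
    (contMDiffAt_of_mem_maximalAtlas (IsManifold.chart_mem_maximalAtlas x) hx)).congr_of_eventuallyEq ?_
  filter_upwards [(chartAt H x).open_source.mem_nhds hx] with y hy
  simp [hc, (chartAt H x).left_inv hy]

/-- Smoothness may be checked after composition with an open embedding which carries charts to
charts. -/
theorem contMDiffAt_of_comp_openEmbedding [Nonempty X] (hf : Topology.IsOpenEmbedding f) (x : X)
    (h : (hf.toOpenPartialHomeomorph f).symm ≫ₕ chartAt H x ∈ IsManifold.maximalAtlas I ∞ M)
    {E' H' N : Type*} [NormedAddCommGroup E'] [NormedSpace ℝ E']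
    [TopologicalSpace H'] {I' : ModelWithCorners ℝ E' H'} [TopologicalSpace N] [ChartedSpace H' N]
    {g : M → N} (hg : ContMDiffAt I I' ∞ (g ∘ f) x) : ContMDiffAt I I' ∞ g (f x) := by
  set c := (hf.toOpenPartialHomeomorph f).symm ≫ₕ chartAt H x with hc
  have hx : x ∈ (chartAt H x).source := mem_chart_source H x
  have hl : ∀ y, (hf.toOpenPartialHomeomorph f).symm (f y) = y :=
    fun y => hf.toOpenPartialHomeomorph_left_inv f
  have hfx : f x ∈ c.source := by simp [hc, hl]
  have hcx : (chartAt H x).symm (c (f x)) = x := by simp [hc, hl]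
  have h1 : ContMDiffAt I I ∞ (chartAt H x).symm (c (f x)) :=
    contMDiffAt_symm_of_mem_maximalAtlas (IsManifold.chart_mem_maximalAtlas x) (by simp [hc, hl])
  rw [← hcx] at hg
  refine ((hg.comp _ h1).comp (f x)
    (contMDiffAt_of_mem_maximalAtlas h hfx)).congr_of_eventuallyEq ?_
  filter_upwards [c.open_source.mem_nhds hfx] with y hy
  simp only [hc, OpenPartialHomeomorph.trans_source, OpenPartialHomeomorph.symm_source,
    Set.mem_inter_iff, Set.mem_preimage] at hy
  obtain ⟨⟨z, -, rfl⟩, hz⟩ := hy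
  have hz' : z ∈ (chartAt H x).source := by simpa [hl] using hz
  simp [hc, hl, (chartAt H x).left_inv hz']

end OpenEmbedding

section
variable {S : Type*} [TopologicalSpace S] [T2Space S] [ChartedSpace ℂ S]
  {J : Type*} [Finite J]

/-- The function on the surface which is `profile (b j) (‖v‖ ^ 2)` at the point `v` of the `j`-th
disc and `1` outside the discs. -/
def DiskSystem.radius (D : DiskSystem S J) (b : J → ℝ) (x : S) : ℝ :=
  open Classical in
  if h : ∃ q : J × ℂ, D.disk q.1 q.2 = x then profile (b h.choose.1) (‖h.choose.2‖ ^ 2) else 1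

namespace DiskSystem

variable (D : DiskSystem S J) {b : J → ℝ}

theorem radius_disk (b : J → ℝ) (j : J) (v : ℂ) :
    D.radius b (D.disk j v) = profile (b j) (‖v‖ ^ 2) := by
  have h : ∃ q : J × ℂ, D.disk q.1 q.2 = D.disk j v := ⟨(j, v), rfl⟩
  have hs := D.eq_of_disk_eq h.choose_spec
  rw [radius, dif_pos h, hs.1, hs.2]

theorem radius_of_forall_ne (b : J → ℝ) {x : S} (h : ∀ j v, D.disk j v ≠ x) :
    D.radius b x = 1 :=
  dif_neg fun ⟨q, hq⟩ => h q.1 q.2 hq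

theorem radius_nonneg (hb : ∀ j, 0 < b j) (x : S) : 0 ≤ D.radius b x := by
  by_cases h : ∃ j v, D.disk j v = x
  · obtain ⟨j, v, rfl⟩ := h
    rw [radius_disk]
    exact profile_nonneg (hb j) (by positivity)
  · push Not at h
    rw [D.radius_of_forall_ne b h]
    exact zero_le_one

theorem radius_eq_one (hb : ∀ j, 0 < b j) {x : S}
    (h : ∀ j v, D.disk j v = x → b j ≤ ‖v‖ ^ 2) : D.radius b x = 1 := by
  by_cases h' : ∃ j v, D.disk j v = x
  · obtain ⟨j, v, rfl⟩ := h'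
    rw [radius_disk, profile_of_ge (hb j) (h j v rfl)]
  · push Not at h'
    exact D.radius_of_forall_ne b h'

theorem radius_eventuallyEq_one (hb : ∀ j, 0 < b j) {x : S}
    (h : ∀ j v, D.disk j v = x → b j < ‖v‖ ^ 2) : D.radius b =ᶠ[𝓝 x] fun _ => 1 := by
  have hc : IsClosed (⋃ j, D.disk j '' Metric.closedBall 0 (√(b j))) :=
    isClosed_iUnion_of_finite fun j =>
      ((isCompact_closedBall _ _).image (D.isLocalDiffeomorph j).contMDiff.continuous).isClosed
  have hx : x ∈ (⋃ j, D.disk j '' Metric.closedBall 0 (√(b j)))ᶜ := by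
    rintro hx
    obtain ⟨j, v, hv, hvx⟩ := Set.mem_iUnion.1 hx
    rw [mem_closedBall_zero_iff] at hv
    have := (Real.le_sqrt (norm_nonneg v) (hb j).le).1 hv
    linarith [h j v hvx]
  filter_upwards [hc.isOpen_compl.mem_nhds hx] with y hy
  refine D.radius_eq_one hb fun j v hv => ?_
  by_contra hlt
  refine hy (Set.mem_iUnion.2 ⟨j, v, ?_, hv⟩)
  rw [mem_closedBall_zero_iff]
  exact (Real.le_sqrt (norm_nonneg v) (hb j).le).2 (not_le.1 hlt).le

theorem contMDiffAt_radius (hb : ∀ j, 0 < b j) {x : S} (hx : x ∈ D.punctured) :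
    ContMDiffAt 𝓘(ℝ, ℂ) 𝓘(ℝ, ℝ) ∞ (D.radius b) x := by
  by_cases h : ∃ j v, D.disk j v = x
  · obtain ⟨j, v, rfl⟩ := h
    have hv : v ≠ 0 := by
      rintro rfl
      exact hx ⟨j, rfl⟩
    have hloc := D.isLocalDiffeomorph j v
    have hψ : hloc.localInverse (D.disk j v) = v :=
      hloc.localInverse_left_inv hloc.localInverse_mem_target
    have h1 : ContMDiffAt 𝓘(ℝ, ℂ) 𝓘(ℝ, ℝ) ∞ (fun v : ℂ => profile (b j) (‖v‖ ^ 2))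
        (hloc.localInverse (D.disk j v)) := by
      rw [hψ, contMDiffAt_iff_contDiffAt]
      exact ContDiffAt.comp (g := profile (b j)) v (contDiffAt_profile (hb j) (by positivity))
        (contDiff_norm_sq ℝ).contDiffAt
    refine (h1.comp _ hloc.localInverse_contMDiffAt).congr_of_eventuallyEq ?_
    filter_upwards [hloc.localInverse.open_source.mem_nhds hloc.localInverse_mem_source] with y hy
    have := hloc.localInverse_right_inv hy
    rw [Function.comp_apply, ← D.radius_disk b j, this]
  · push Not at h
    exact contMDiffAt_const.congr_of_eventuallyEq
      (D.radius_eventuallyEq_one hb fun j v hv => absurd hv (h j v))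

end DiskSystem

namespace SeifertManifold

variable {D : DiskSystem S J} {p : J → ℤ} {b : J → ℝ} 

theorem outerChart_mem_maximalAtlas [IsManifold 𝓘(ℝ, ℂ) ∞ S] (q : Circle × D.punctured) :
    outerChart q ∈ IsManifold.maximalAtlas Model3 ∞ (SeifertManifold D p) :=
  IsManifold.subset_maximalAtlas (Or.inl ⟨q, rfl⟩)

theorem torusChart_mem_maximalAtlas [IsManifold 𝓘(ℝ, ℂ) ∞ S] (j : J) (q : Circle × ℂ) :
    torusChart j q ∈ IsManifold.maximalAtlas Model3 ∞ (SeifertManifold D p) :=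
  IsManifold.subset_maximalAtlas (Or.inr (Set.mem_iUnion.2 ⟨j, q, rfl⟩))

theorem contMDiff_outer [IsManifold 𝓘(ℝ, ℂ) ∞ S] : ContMDiff Model3 Model3 ∞
    (outer : Circle × D.punctured → SeifertManifold D p) := fun q =>
  haveI : Nonempty (Circle × D.punctured) := ⟨q⟩
  contMDiffAt_of_chart_mem isOpenEmbedding_outer q (outerChart_mem_maximalAtlas q)

theorem contMDiff_torus [IsManifold 𝓘(ℝ, ℂ) ∞ S] (j : J) :
    ContMDiff Model3 Model3 ∞ (torus D p j) := fun q =>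
  contMDiffAt_of_chart_mem (isOpenEmbedding_torus j) q (torusChart_mem_maximalAtlas j q)

/-- A map to the plane whose zero set is the binding, and whose argument is the open book fibration
on the complement of the binding. Its modulus is the function `D.radius b` on each page. -/
def openBookMap (D : DiskSystem S J) (p : J → ℤ) (b : J → ℝ) : SeifertManifold D p → ℂ
  | outer q => (D.radius b q.2 : ℂ) * q.1
  | core _ _ => 0

theorem norm_glue_snd (p : ℤ) (q : Circle × ℂ) : ‖(glue p q).2‖ = ‖q.2‖ := by
  simp only [glue, norm_mul, Circle.norm_coe, mul_one, Complex.norm_real, norm_norm]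

/-- Near a core the open book map is the multiple `w z ^ p` of the disc coordinate, which is why it is
smooth there: its modulus is linear in the radius, and its argument is `μ + p λ`. -/
theorem openBookMap_torus (hb : ∀ j, 0 < b j) (j : J) {q : Circle × ℂ} (hq : ‖q.2‖ ^ 2 ≤ b j / 2) :
    openBookMap D p b (torus D p j q) = (√(b j) : ℂ)⁻¹ * (q.2 * (q.1 ^ p j : Circle)) := by
  by_cases h0 : q.2 = 0
  · simp [torus_of_eq h0, openBookMap, h0]
  · have hn : profile (b j) (‖(glue (p j) q).2‖ ^ 2) = ‖q.2‖ / √(b j) := by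
      rw [norm_glue_snd, profile_of_le_half (hb j) hq, Real.sqrt_div (by positivity),
        Real.sqrt_sq (norm_nonneg _)]
    rw [torus_of_ne h0]
    have h1 : openBookMap D p b (outer ((glue (p j) q).1,
        ⟨D.disk j (glue (p j) q).2, D.disk_mem_punctured j (glue_snd_ne_zero.2 h0)⟩)) =
        ((‖q.2‖ / √(b j) : ℝ) : ℂ) * ((phase q.2 * q.1 ^ p j : Circle) : ℂ) := by
      rw [← hn, ← D.radius_disk b j]; rfl
    have h2 := norm_mul_phase q.2
    rw [h1, Circle.coe_mul, Complex.ofReal_div]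
    linear_combination ((√(b j) : ℂ)⁻¹ * ((q.1 ^ p j : Circle) : ℂ)) * h2

theorem contMDiff_openBookMap [IsManifold 𝓘(ℝ, ℂ) ∞ S] (hb : ∀ j, 0 < b j) :
    ContMDiff Model3 𝓘(ℝ, ℂ) ∞ (openBookMap D p b) := by
  have hm : ContMDiff (𝓘(ℝ, ℂ).prod 𝓘(ℝ, ℂ)) 𝓘(ℝ, ℂ) ∞ (fun z : ℂ × ℂ => z.1 * z.2) := by
    rw [contMDiff_iff]
    exact ⟨continuous_mul, fun x y => contDiff_mul.contDiffOn⟩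
  intro y
  cases y with
  | outer q =>
    have : Nonempty (Circle × D.punctured) := ⟨q⟩
    refine contMDiffAt_of_comp_openEmbedding isOpenEmbedding_outer q
      (outerChart_mem_maximalAtlas q) ?_
    have h1 : ContMDiffAt Model3 𝓘(ℝ, ℝ) ∞
        (fun q : Circle × D.punctured => D.radius b q.2) q :=
      (D.contMDiffAt_radius hb q.2.2).comp q
        (contMDiff_subtype_val.contMDiffAt.comp q contMDiffAt_snd)
    have h2 : ContMDiffAt Model3 𝓘(ℝ, ℂ) ∞
        (fun q : Circle × D.punctured => (D.radius b q.2 : ℂ)) q :=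
      Complex.ofRealCLM.contMDiff.contMDiffAt.comp q h1
    exact hm.contMDiffAt.comp q
      (h2.prodMk (contMDiff_coe_circle.contMDiffAt.comp q contMDiffAt_fst))
  | core j z =>
    have h0 : core j z = torus D p j (z, 0) := by simp [torus]
    rw [h0]
    refine contMDiffAt_of_comp_openEmbedding (isOpenEmbedding_torus j) (z, 0)
      (torusChart_mem_maximalAtlas j (z, 0)) ?_
    have h1 : ContMDiff Model3 𝓘(ℝ, ℂ) ∞
        (fun q : Circle × ℂ => (√(b j) : ℂ)⁻¹ * (q.2 * (q.1 ^ p j : Circle))) :=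
      hm.comp (contMDiff_const.prodMk (hm.comp (contMDiff_snd.prodMk
        (contMDiff_coe_circle.comp ((contMDiff_zpow (p j)).comp contMDiff_fst)))))
    refine h1.contMDiffAt.congr_of_eventuallyEq ?_
    have hev : ∀ᶠ q : Circle × ℂ in 𝓝 (z, 0), ‖q.2‖ ^ 2 < b j / 2 := by
      refine (isOpen_lt (by fun_prop) (by fun_prop)).mem_nhds ?_
      simpa using hb j
    filter_upwards [hev] with q hq
    exact openBookMap_torus hb j hq.le

end SeifertManifold

end

/-! ### Velocities, and estimates near and away from the binding -/

/-- The preferred charts of an open set are restrictions of those of the surface, so that in these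
coordinates its inclusion has the identity as differential. -/
theorem mfderiv_opens_subtypeVal {S : Type*} [TopologicalSpace S] [ChartedSpace ℂ S]
    [IsManifold 𝓘(ℝ, ℂ) ∞ S] {U : Opens S} (x : U) (v : ℂ) :
    mfderiv 𝓘(ℝ, ℂ) 𝓘(ℝ, ℂ) (Subtype.val : U → S) x v = v := by
  have hd : MDifferentiableAt 𝓘(ℝ, ℂ) 𝓘(ℝ, ℂ) (Subtype.val : U → S) x :=
    (contMDiff_subtype_val (n := ∞)).contMDiffAt.mdifferentiableAt (by simp)
  have heq : writtenInExtChartAt 𝓘(ℝ, ℂ) 𝓘(ℝ, ℂ) x (Subtype.val : U → S) =ᶠ[𝓝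
      (extChartAt 𝓘(ℝ, ℂ) x x)] id := by
    filter_upwards [extChartAt_target_mem_nhds (I := 𝓘(ℝ, ℂ)) x] with z hz
    exact (extChartAt 𝓘(ℝ, ℂ) x).right_inv hz
  have h : fderivWithin ℝ (writtenInExtChartAt 𝓘(ℝ, ℂ) 𝓘(ℝ, ℂ) x (Subtype.val : U → S))
      (Set.range 𝓘(ℝ, ℂ)) (extChartAt 𝓘(ℝ, ℂ) x x) = ContinuousLinearMap.id ℝ ℂ := by
    rw [modelWithCornersSelf_coe, Set.range_id, fderivWithin_univ, heq.fderiv_eq, fderiv_id]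
  exact congrArg (fun L : ℂ →L[ℝ] ℂ => L v) (hd.mfderiv.trans h)

theorem mfderiv_one_of_hasDerivAt {V : Type*} [NormedAddCommGroup V] [NormedSpace ℝ V]
    {γ : ℝ → V} {γ' : V} {t : ℝ} (h : HasDerivAt γ γ' t) :
    mfderiv 𝓘(ℝ, ℝ) 𝓘(ℝ, V) γ t (1 : ℝ) = γ' := by
  rw [h.hasFDerivAt.hasMFDerivAt.mfderiv]
  exact one_smul ℝ γ'

/-- `A^* (a ∧ l) = det A • (a ∧ l)` in the plane. -/
theorem wedge_comp_eq_det_mul (A : ℂ →L[ℝ] ℂ) (a l : ℂ →L[ℝ] ℝ) :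
    a (A 1) * l (A Complex.I) - a (A Complex.I) * l (A 1) =
      A.det * (a 1 * l Complex.I - a Complex.I * l 1) := by
  have hdet : A.det = (A 1).re * (A Complex.I).im - (A 1).im * (A Complex.I).re := by
    rw [ContinuousLinearMap.det, ← LinearMap.det_toMatrix Complex.basisOneI, Matrix.det_fin_two]
    simp [LinearMap.toMatrix_apply]
    ring
  have hexp : ∀ (f : ℂ →L[ℝ] ℝ) (z : ℂ), f z = z.re * f 1 + z.im * f Complex.I := by
    intro f z
    conv_lhs => rw [show z = z.re • (1 : ℂ) + z.im • Complex.I by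
      simp [Complex.re_add_im]]
    rw [map_add, map_smul, map_smul, smul_eq_mul, smul_eq_mul]
  rw [hdet, hexp a (A 1), hexp a (A Complex.I), hexp l (A 1), hexp l (A Complex.I)]
  ring

section
variable {S : Type*} [TopologicalSpace S] [T2Space S] [ChartedSpace ℂ S]
  [IsManifold 𝓘(ℝ, ℂ) ∞ S] {J : Type*} [Finite J]

namespace DiskSystem

variable (D : DiskSystem S J) {b : J → ℝ}

/-- The `j`-th disc as a map to the punctured surface; the value at the centre is irrelevant. -/
def puncturedDisk (j : J) (v : ℂ) : D.punctured :=
  open Classical in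
  if h : v ≠ 0 then ⟨D.disk j v, D.disk_mem_punctured j h⟩
  else ⟨D.disk j 1, D.disk_mem_punctured j one_ne_zero⟩

theorem puncturedDisk_of_ne (j : J) {v : ℂ} (h : v ≠ 0) :
    D.puncturedDisk j v = ⟨D.disk j v, D.disk_mem_punctured j h⟩ := dif_pos h

theorem eventuallyEq_subtypeVal_comp_puncturedDisk (j : J) {v : ℂ} (h : v ≠ 0) :
    Subtype.val ∘ D.puncturedDisk j =ᶠ[𝓝 v] D.disk j := by
  filter_upwards [isOpen_ne.mem_nhds h] with w hw
  rw [Function.comp_apply, D.puncturedDisk_of_ne j hw]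

theorem contMDiffAt_puncturedDisk (j : J) {v : ℂ} (h : v ≠ 0) :
    ContMDiffAt 𝓘(ℝ, ℂ) 𝓘(ℝ, ℂ) ∞ (D.puncturedDisk j) v := by
  rw [← ContMDiffAt.subtypeVal_comp_iff]
  exact (D.isLocalDiffeomorph j).contMDiff.contMDiffAt.congr_of_eventuallyEq
    (D.eventuallyEq_subtypeVal_comp_puncturedDisk j h)

theorem det_mfderiv_puncturedDisk_pos (j : J) {v : ℂ} (h : v ≠ 0) :
    0 < (show ℂ →L[ℝ] ℂ from mfderiv 𝓘(ℝ, ℂ) 𝓘(ℝ, ℂ) (D.puncturedDisk j) v).det := by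
  convert D.det_pos j v using 2
  have h1 := (D.eventuallyEq_subtypeVal_comp_puncturedDisk j h).mfderiv_eq
    (I := 𝓘(ℝ, ℂ)) (I' := 𝓘(ℝ, ℂ))
  rw [mfderiv_comp v (I' := 𝓘(ℝ, ℂ))
    ((contMDiff_subtype_val (n := ∞)).contMDiffAt.mdifferentiableAt (by simp))
    ((D.contMDiffAt_puncturedDisk j h).mdifferentiableAt (by simp))] at h1
  refine ContinuousLinearMap.ext fun w => ?_
  refine Eq.trans ?_ (congrArg (fun L : ℂ →L[ℝ] ℂ => L w) h1)
  exact (mfderiv_opens_subtypeVal _ _).symm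

/-- On a disc the differential of `D.radius b` at `v` is a nonnegative multiple of the inner product
with `v`, because the function is radial and nondecreasing. -/
theorem exists_fderiv_profile_eq {b : ℝ} (hb : 0 < b) {v : ℂ} (hv : v ≠ 0) :
    ∃ κ : ℝ, 0 ≤ κ ∧ (b < ‖v‖ ^ 2 → κ = 0) ∧
      ∀ w, fderiv ℝ (fun v : ℂ => profile b (‖v‖ ^ 2)) v w = κ * (v.re * w.re + v.im * w.im) := by
  have hpos : 0 < ‖v‖ ^ 2 := by positivity
  have h1 : HasDerivAt (profile b) (deriv (profile b) (‖v‖ ^ 2)) (‖v‖ ^ 2) :=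
    ((contDiffAt_profile hb hpos).differentiableAt (by simp)).hasDerivAt
  have h2 : HasFDerivAt (fun v : ℂ => ‖v‖ ^ 2) (2 • innerSL ℝ v) v :=
    (hasStrictFDerivAt_norm_sq v).hasFDerivAt
  have h3 := h1.comp_hasFDerivAt v h2
  refine ⟨2 * deriv (profile b) (‖v‖ ^ 2), ?_, ?_, fun w => ?_⟩
  · exact mul_nonneg zero_le_two (profile_monotone hb).deriv_nonneg
  · intro hlt
    have : profile b =ᶠ[𝓝 (‖v‖ ^ 2)] fun _ => 1 := by
      filter_upwards [lt_mem_nhds hlt] with s hs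
      exact profile_of_ge hb hs.le
    rw [this.deriv_eq]; simp
  · have h4 : fderiv ℝ (fun v : ℂ => profile b (‖v‖ ^ 2)) v = _ := h3.fderiv
    rw [h4]
    simp [Complex.inner]
    ring

end DiskSystem

namespace SeifertManifold

variable {D : DiskSystem S J} {p : J → ℤ} {b : J → ℝ}

/-- The value of a 1-form on the velocity at time `0` of a curve. -/
def onVelocity (α : OneForm Model3 (SeifertManifold D p)) (c : ℝ → SeifertManifold D p) : ℝ :=
  α (c 0) (velocity c)

theorem onVelocity_comp (α : OneForm Model3 (SeifertManifold D p)) {V : Type*}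
    [NormedAddCommGroup V] [NormedSpace ℝ V] {T : V → SeifertManifold D p} {γ : ℝ → V} {x γ' : V}
    (hT : MDifferentiableAt 𝓘(ℝ, V) Model3 T x) (hγ : HasDerivAt γ γ' 0) (hx : γ 0 = x) :
    onVelocity α (fun t => T (γ t)) = α (T x) (mfderiv 𝓘(ℝ, V) Model3 T x γ') := by
  subst hx
  have h : mfderiv 𝓘(ℝ, ℝ) Model3 (T ∘ γ) 0 (1 : ℝ) = mfderiv 𝓘(ℝ, V) Model3 T (γ 0) γ' := by
    rw [mfderiv_comp (0 : ℝ) (I' := 𝓘(ℝ, V)) hT hγ.differentiableAt.mdifferentiableAt]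
    have h2 : mfderiv 𝓘(ℝ, ℝ) 𝓘(ℝ, V) γ 0 (1 : ℝ) = γ' :=
      mfderiv_one_of_hasDerivAt hγ
    exact congrArg (mfderiv 𝓘(ℝ, V) Model3 T (γ 0)) h2
  exact congrArg (α (T (γ 0))) h

theorem mfderiv_velocity {F : SeifertManifold D p → ℂ} {c : ℝ → SeifertManifold D p} {F' : ℂ}
    (hF : MDifferentiableAt Model3 𝓘(ℝ, ℂ) F (c 0)) (hc : MDifferentiableAt 𝓘(ℝ, ℝ) Model3 c 0)
    (h : HasDerivAt (fun t => F (c t)) F' 0) :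
    mfderiv Model3 𝓘(ℝ, ℂ) F (c 0) (velocity c) = F' := by
  have h1 : mfderiv 𝓘(ℝ, ℝ) 𝓘(ℝ, ℂ) (F ∘ c) 0 (1 : ℝ) = F' :=
    mfderiv_one_of_hasDerivAt h
  rw [← h1, mfderiv_comp (0 : ℝ) (I' := Model3) hF hc]
  rfl

theorem apply_fiberVector (α : OneForm Model3 (SeifertManifold D p)) (y : SeifertManifold D p) :
    α y (fiberVector y) = onVelocity α (fiberCurve y) :=
  α.congr_point (fiberCurve_zero y).symm _

theorem apply_bindingVector (α : OneForm Model3 (SeifertManifold D p)) (j : J) (z : Circle) :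
    α (core j z) (bindingVector D p j z) = onVelocity α fun t => core j (Circle.exp t * z) :=
  α.congr_point (by simp) _

theorem hasDerivAt_coe_exp (a : ℝ) (w : ℂ) :
    HasDerivAt (fun t : ℝ => (Circle.exp (a * t) : ℂ) * w) (a * Complex.I * w) 0 := by
  have h1 : HasDerivAt (fun t : ℝ => ((a * t : ℝ) : ℂ) * Complex.I) (a * Complex.I) 0 := by
    have := ((hasDerivAt_id (0 : ℝ)).const_mul a).ofReal_comp.mul_const Complex.I
    simpa using this
  have h2 := (h1.cexp).mul_const w
  simpa [Circle.coe_exp] using h2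

theorem contMDiff_exp_fst {V : Type*} [NormedAddCommGroup V] [NormedSpace ℝ V] :
    ContMDiff 𝓘(ℝ, ℝ × V) (𝓡 1) ∞ (fun q : ℝ × V => Circle.exp q.1) :=
  contMDiff_circleExp.comp contDiff_fst.contMDiff

variable (D p) in
/-- The universal cover of the `j`-th surgery torus. -/
def torusCover (j : J) (q : ℝ × ℂ) : SeifertManifold D p := torus D p j (Circle.exp q.1, q.2)

theorem contMDiff_torusCover (j : J) :
    ContMDiff 𝓘(ℝ, ℝ × ℂ) Model3 ∞ (torusCover D p j) :=
  (contMDiff_torus j).comp (contMDiff_exp_fst.prodMk contDiff_snd.contMDiff)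

theorem onVelocity_torus (α : OneForm Model3 (SeifertManifold D p)) (j : J) (a b s : ℝ) (w : ℂ) :
    onVelocity α (fun t => torus D p j (Circle.exp (a * t) * Circle.exp s,
      (Circle.exp (b * t) : ℂ) * w)) = α (torusCover D p j (s, w))
        (mfderiv 𝓘(ℝ, ℝ × ℂ) Model3 (torusCover D p j) (s, w) (a, b * Complex.I * w)) := by
  have hγ : HasDerivAt (fun t : ℝ => (a * t + s, (Circle.exp (b * t) : ℂ) * w))
      (a, b * Complex.I * w) 0 := by
    refine HasDerivAt.prodMk ?_ (hasDerivAt_coe_exp b w)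
    simpa using ((hasDerivAt_id (0 : ℝ)).const_mul a).add_const s
  rw [← onVelocity_comp α ((contMDiff_torusCover j).mdifferentiableAt (by simp)) hγ (by simp)]
  simp only [torusCover, Circle.exp_add]

/-- Near the core the value of a 1-form on the vector field `a λ + b μ` of a surgery torus is
positive if it is so on the core. -/
theorem exists_pos_near_core {α : OneForm Model3 (SeifertManifold D p)} (hα : α.IsSmooth) (j : J)
    {a : ℝ} (b : ℝ) (ha : 0 < a) (hpos : ∀ z, 0 < α (core j z) (bindingVector D p j z)) :
    ∃ ε > 0, ∀ (z : Circle) (w : ℂ), ‖w‖ ≤ ε → 0 < onVelocity α fun t =>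
      torus D p j (Circle.exp (a * t) * z, (Circle.exp (b * t) : ℂ) * w) := by
  set g : ℝ × ℂ → ℝ := fun q => α (torusCover D p j q)
    (mfderiv 𝓘(ℝ, ℝ × ℂ) Model3 (torusCover D p j) q (a, b * Complex.I * q.2)) with hg
  have hcont : Continuous g := continuous_iff_continuousAt.2 fun q =>
    hα.continuousAt_comp_mfderiv (contMDiff_torusCover j).contMDiffAt
      (ν := fun q => (a, b * Complex.I * q.2)) (by fun_prop)
  -- On the core the field is `a λ`, whatever `b` is.
  have h0 : ∀ s, 0 < g (s, 0) := by
    intro s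
    have h1 := hpos (Circle.exp s)
    have h2 := onVelocity_torus α j 1 0 s 0
    have h3 : (fun t => torus D p j (Circle.exp (1 * t) * Circle.exp s,
        (Circle.exp (0 * t) : ℂ) * 0)) = fun t => core j (Circle.exp t * Circle.exp s) := by
      funext t; rw [torus_of_eq (by simp)]; simp
    rw [h3, ← apply_bindingVector] at h2
    have h4 : ((a, b * Complex.I * 0) : ℝ × ℂ) = a • ((1, ((0 : ℝ) : ℂ) * Complex.I * 0) : ℝ × ℂ) := by
      simp
    have h5 : g (s, 0) = a * α (core j (Circle.exp s)) (bindingVector D p j (Circle.exp s)) := by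
      rw [h2, hg]
      simp only [h4]
      exact (congrArg _ (map_smul (mfderiv 𝓘(ℝ, ℝ × ℂ) Model3 (torusCover D p j) (s, 0)) a _)).trans
        (map_smul (α (torusCover D p j (s, 0))) a _)
    rw [h5]
    exact mul_pos ha h1
  have hev : ∀ᶠ w in 𝓝 (0 : ℂ), ∀ s ∈ Set.Icc (-Real.pi) Real.pi, 0 < g (s, w) := by
    refine isCompact_Icc.eventually_forall_of_forall_eventually fun s _ => ?_
    have : ContinuousAt (fun q : ℂ × ℝ => g (q.2, q.1)) (0, s) :=
      (hcont.comp continuous_swap).continuousAt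
    exact this.eventually_const_lt (h0 s)
  obtain ⟨ε, hε, hball⟩ := Metric.eventually_nhds_iff.1 hev
  refine ⟨ε / 2, by positivity, fun z w hw => ?_⟩
  have h1 := hball (y := w) (by rw [dist_zero_right]; linarith) (Complex.arg z)
    ⟨(Complex.neg_pi_lt_arg _).le, Complex.arg_le_pi _⟩
  rw [hg] at h1
  simp only at h1
  rw [← onVelocity_torus, Circle.exp_arg] at h1
  exact h1

/-- Off a neighbourhood of the binding a 1-form is bounded below on the Seifert fibres. -/
theorem exists_bound_onVelocity_fiberCurve [CompactSpace S]
    {α : OneForm Model3 (SeifertManifold D p)} (hα : α.IsSmooth) {ε : J → ℝ} (hε : ∀ j, 0 < ε j) :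
    ∃ C, 0 ≤ C ∧ ∀ (l : Circle) (x : D.punctured), (∀ j v, D.disk j v = x → ε j ≤ ‖v‖) →
      -C ≤ onVelocity α (fiberCurve (outer (l, x))) := by
  set K : Set D.punctured := {x | ∀ j, (x : S) ∉ D.disk j '' Metric.ball 0 (ε j)} with hKdef
  have hK : IsCompact K := by
    rw [Topology.IsEmbedding.subtypeVal.isCompact_iff]
    have hc : IsClosed (⋃ j, D.disk j '' Metric.ball 0 (ε j))ᶜ :=
      (isOpen_iUnion fun j => (D.isLocalDiffeomorph j).isOpenMap _ Metric.isOpen_ball).isClosed_compl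
    convert hc.isCompact using 1
    ext x
    constructor
    · rintro ⟨x, hx, rfl⟩
      simpa [hKdef] using hx
    · intro hx
      have hx' : ∀ j, x ∉ D.disk j '' Metric.ball 0 (ε j) := by simpa using hx
      refine ⟨⟨x, ?_⟩, hx', rfl⟩
      rintro ⟨j, hj⟩
      exact hx' j ⟨0, by simp [hε j], hj⟩
  set g : ℝ × D.punctured → ℝ := fun q => onVelocity α (fiberCurve (outer (Circle.exp q.1, q.2)))
  have hcont : Continuous g := by
    rw [continuous_iff_continuousAt]
    rintro ⟨s, x₀⟩
    set χ := extChartAt 𝓘(ℝ, ℂ) x₀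
    set T : ℝ × ℂ → SeifertManifold D p := fun q => outer (Circle.exp q.1, χ.symm q.2) with hTdef
    have hT : ∀ q : ℝ × ℂ, q.2 ∈ χ.target → ContMDiffAt 𝓘(ℝ, ℝ × ℂ) Model3 ∞ T q := by
      intro q hq
      have h1 : ContMDiffAt 𝓘(ℝ, ℂ) 𝓘(ℝ, ℂ) ∞ χ.symm q.2 :=
        (contMDiffOn_extChartAt_symm x₀).contMDiffAt ((isOpen_extChartAt_target x₀).mem_nhds hq)
      exact contMDiff_outer.contMDiffAt.comp q (contMDiff_exp_fst.contMDiffAt.prodMk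
        (h1.comp q contDiff_snd.contMDiff.contMDiffAt))
    have hx₀ : χ x₀ ∈ χ.target := mem_extChartAt_target x₀
    have h1 := hα.continuousAt_comp_mfderiv (hT (s, χ x₀) hx₀)
      (ν := fun _ => (1, 0)) continuousAt_const
    have h2 : ContinuousAt (fun q : ℝ × D.punctured => (q.1, χ q.2)) (s, x₀) :=
      continuousAt_fst.prodMk ((continuousAt_extChartAt (I := 𝓘(ℝ, ℂ)) x₀).comp
        (f := fun q : ℝ × D.punctured => q.2) (x := (s, x₀)) continuousAt_snd)
    refine (ContinuousAt.comp (f := fun q : ℝ × D.punctured => (q.1, χ q.2)) h1 h2).congr ?_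
    have hev : ∀ᶠ q : ℝ × D.punctured in 𝓝 (s, x₀), q.2 ∈ χ.source :=
      continuousAt_snd.eventually_mem (extChartAt_source_mem_nhds x₀)
    filter_upwards [hev] with q hq
    have hγ : HasDerivAt (fun t : ℝ => (t + q.1, χ q.2)) (1, 0) 0 :=
      ((hasDerivAt_id (0 : ℝ)).add_const q.1).prodMk (hasDerivAt_const _ _)
    have := onVelocity_comp α
      ((hT (q.1, χ q.2) (χ.map_source hq)).mdifferentiableAt (by simp)) hγ (by simp)
    refine this.symm.trans (congrArg (onVelocity α) ?_)
    funext t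
    simp only [hTdef, fiberCurve, Circle.exp_add, χ.left_inv hq]
  obtain ⟨C, hC⟩ := (isCompact_Icc (a := -Real.pi) (b := Real.pi)).prod hK
    |>.exists_bound_of_continuousOn hcont.continuousOn
  refine ⟨|C|, abs_nonneg _, fun l x hx => ?_⟩
  have hxK : x ∈ K := by
    rintro j ⟨v, hv, hvx⟩
    have := hx j v hvx
    rw [mem_ball_zero_iff] at hv
    linarith
  have h := hC (Complex.arg l, x) ⟨⟨(Complex.neg_pi_lt_arg _).le, Complex.arg_le_pi _⟩, hxK⟩
  simp only [g, Circle.exp_arg, Real.norm_eq_abs] at h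
  linarith [neg_abs_le (onVelocity α (fiberCurve (outer (l, x)))), le_abs_self C]

end SeifertManifold

end

/-! ### The open book map on the frames -/

theorem areaForm_mul_circle (x y : ℂ) (l : Circle) : areaForm (x * l) (y * l) = areaForm x y := by
  have hl : (l : ℂ).re * (l : ℂ).re + (l : ℂ).im * (l : ℂ).im = 1 := by
    have := Circle.normSq_coe l
    rwa [Complex.normSq_apply] at this
  simp only [areaForm_apply, Complex.mul_re, Complex.mul_im]
  linear_combination (x.re * y.im - x.im * y.re) * hl

theorem phase_circle_mul (c : Circle) {w : ℂ} (hw : w ≠ 0) : phase (c * w) = c * phase w := by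
  rw [show (c : ℂ) * w = (‖w‖ : ℂ) * ((c * phase w : Circle) : ℂ) by
    conv_lhs => rw [← norm_mul_phase w]
    rw [Circle.coe_mul]; ring]
  exact phase_mul_coe (norm_pos_iff.2 hw) _

/-- Going around the meridian `m` of a fibre is going around `p μ - λ` in the surgery torus. -/
theorem glue_meridian (p : ℤ) (z : Circle) {w : ℂ} (hw : w ≠ 0) (t : ℝ) :
    glue p (Circle.exp (-1 * t) * z, (Circle.exp (p * t) : ℂ) * w) =
      ((glue p (z, w)).1, (Circle.exp t : ℂ) * (glue p (z, w)).2) := by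
  have h1 : Circle.exp (-1 * t) = (Circle.exp t)⁻¹ := by
    rw [← Circle.exp_neg]; congr 1; ring
  have h2 : Circle.exp (p * t) = Circle.exp t ^ p := by
    rw [← Circle.exp_zsmul]; simp
  set c := Circle.exp t
  rw [h1, h2]
  simp only [glue, phase_circle_mul _ hw, norm_mul, Circle.norm_coe, one_mul, mul_zpow, inv_zpow]
  ext1
  · simp only
    rw [mul_mul_mul_comm, mul_inv_cancel, one_mul]
  · simp only
    rw [mul_mul_mul_comm, ← zpow_mul, ← zpow_neg, ← zpow_add,
      show p * p + -(p ^ 2 - 1) = 1 by ring, zpow_one, Circle.coe_mul c]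
    ring

section
variable {S : Type*} [TopologicalSpace S] [T2Space S] [ChartedSpace ℂ S]
  [IsManifold 𝓘(ℝ, ℂ) ∞ S] {J : Type*} [Finite J]

namespace SeifertManifold

variable {D : DiskSystem S J} {p : J → ℤ} {b : J → ℝ}

theorem mfderiv_congr_point (F : SeifertManifold D p → ℂ) {y y' : SeifertManifold D p}
    (h : y = y') (v : EuclideanSpace ℝ (Fin 1) × ℂ) :
    (show ℂ from mfderiv Model3 𝓘(ℝ, ℂ) F y v) = mfderiv Model3 𝓘(ℝ, ℂ) F y' v := by
  subst h; rfl

theorem contMDiff_page (l : Circle) : ContMDiff 𝓘(ℝ, ℂ) Model3 ∞ (page D p l) :=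
  contMDiff_outer.comp (contMDiff_const.prodMk contMDiff_id)

theorem contMDiff_meridianDisk (j : J) (z : Circle) :
    ContMDiff 𝓘(ℝ, ℂ) Model3 ∞ (meridianDisk D p j z) :=
  (contMDiff_torus j).comp (contMDiff_const.prodMk contMDiff_id)

/-- The differential of `D.radius b` on the punctured surface. -/
def dradius (D : DiskSystem S J) (b : J → ℝ) (x : D.punctured) : ℂ →L[ℝ] ℝ :=
  mfderiv 𝓘(ℝ, ℂ) 𝓘(ℝ, ℝ) (fun x : D.punctured => D.radius b x) x

theorem contMDiffAt_radius_punctured (hb : ∀ j, 0 < b j) (x : D.punctured) :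
    ContMDiffAt 𝓘(ℝ, ℂ) 𝓘(ℝ, ℝ) ∞ (fun x : D.punctured => D.radius b x) x :=
  (D.contMDiffAt_radius hb x.2).comp x contMDiff_subtype_val.contMDiffAt

theorem mfderiv_openBookMap_page (hb : ∀ j, 0 < b j) (l : Circle) (x : D.punctured) (a : ℂ) :
    mfderiv Model3 𝓘(ℝ, ℂ) (openBookMap D p b) (page D p l x)
      (mfderiv 𝓘(ℝ, ℂ) Model3 (page D p l) x a) = ((dradius D b x a : ℂ) * l : ℂ) := by
  set L : ℝ →L[ℝ] ℂ := ContinuousLinearMap.toSpanSingleton ℝ (l : ℂ)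
  have h1 : openBookMap D p b ∘ page D p l = L ∘ fun x : D.punctured => D.radius b x := by
    funext x
    simp [openBookMap, page, L]
  have h2 := mfderiv_comp x (I' := Model3)
    ((contMDiff_openBookMap (p := p) hb).mdifferentiableAt (x := page D p l x) (by simp))
    ((contMDiff_page (p := p) l).mdifferentiableAt (x := x) (by simp))
  have h3 := mfderiv_comp x (I' := 𝓘(ℝ, ℝ)) (L.hasMFDerivAt (x := D.radius b x)).mdifferentiableAt
    ((contMDiffAt_radius_punctured hb x).mdifferentiableAt (by simp))
  rw [h1, h3, L.hasMFDerivAt.mfderiv] at h2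
  have h4 : L (dradius D b x a) = (dradius D b x a : ℂ) * l := by simp [L]
  rw [← h4]
  exact (congrArg (fun A : ℂ →L[ℝ] ℂ => A a) h2).symm

theorem mfderiv_openBookMap_fiberVector (hb : ∀ j, 0 < b j) (l : Circle) (x : D.punctured) :
    mfderiv Model3 𝓘(ℝ, ℂ) (openBookMap D p b) (outer (l, x)) (fiberVector (outer (l, x))) =
      ((Complex.I * D.radius b x) * l : ℂ) := by
  have hc : ContMDiff 𝓘(ℝ, ℝ) Model3 ∞ (fiberCurve (outer (l, x) : SeifertManifold D p)) :=
    contMDiff_outer.comp ((contMDiff_circleExp.mul contMDiff_const).prodMk contMDiff_const)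
  have hd : HasDerivAt (fun t => openBookMap D p b (fiberCurve (outer (l, x)) t))
      ((Complex.I * D.radius b x) * l) 0 := by
    have h := (hasDerivAt_coe_exp 1 (l : ℂ)).const_mul (D.radius b x : ℂ)
    refine (h.congr_deriv (by push_cast; ring)).congr_of_eventuallyEq (Filter.Eventually.of_forall ?_)
    intro t
    simp [fiberCurve, openBookMap]
  have h := mfderiv_velocity ((contMDiff_openBookMap hb).mdifferentiableAt (by simp))
    (hc.mdifferentiableAt (by simp)) hd
  exact (mfderiv_congr_point _ (fiberCurve_zero (outer (l, x))).symm _).trans h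

theorem mfderiv_openBookMap_bindingVector (hb : ∀ j, 0 < b j) (j : J) (z : Circle) :
    mfderiv Model3 𝓘(ℝ, ℂ) (openBookMap D p b) (core j z) (bindingVector D p j z) = (0 : ℂ) := by
  have hc : ContMDiff 𝓘(ℝ, ℝ) Model3 ∞
      (fun t => (core j (Circle.exp t * z) : SeifertManifold D p)) := by
    have h := (contMDiff_torus (D := D) (p := p) j).comp
      ((contMDiff_circleExp.mul (contMDiff_const (c := z))).prodMk
        (contMDiff_const (I' := 𝓘(ℝ, ℂ)) (c := (0 : ℂ))))
    convert h using 1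
    funext t
    exact (torus_of_eq (q := (Circle.exp t * z, 0)) rfl).symm
  have h := mfderiv_velocity ((contMDiff_openBookMap (p := p) hb).mdifferentiableAt (by simp))
    (hc.mdifferentiableAt (by simp)) (hasDerivAt_const (0 : ℝ) (0 : ℂ))
  exact (mfderiv_congr_point _ (by simp) _).trans h

theorem mfderiv_openBookMap_meridianDisk (hb : ∀ j, 0 < b j) (j : J) (z : Circle) (a : ℂ) :
    mfderiv Model3 𝓘(ℝ, ℂ) (openBookMap D p b) (core j z)
      (mfderiv 𝓘(ℝ, ℂ) Model3 (meridianDisk D p j z) 0 a) =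
        (((√(b j) : ℂ)⁻¹ * a) * (z ^ p j : Circle) : ℂ) := by
  set L : ℂ →L[ℝ] ℂ := ContinuousLinearMap.mul ℝ ℂ ((√(b j) : ℂ)⁻¹ * (z ^ p j : Circle))
  have h1 : openBookMap D p b ∘ meridianDisk D p j z =ᶠ[𝓝 0] L := by
    have hev : ∀ᶠ w : ℂ in 𝓝 0, ‖w‖ ^ 2 < b j / 2 := by
      refine (isOpen_lt (by fun_prop) (by fun_prop)).mem_nhds ?_
      simpa using hb j
    filter_upwards [hev] with w hw
    rw [Function.comp_apply, meridianDisk, openBookMap_torus hb j hw.le]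
    simp only [L, ContinuousLinearMap.mul_apply']
    ring
  have h2 := mfderiv_comp (0 : ℂ) (I' := Model3)
    ((contMDiff_openBookMap (p := p) hb).mdifferentiableAt (x := meridianDisk D p j z 0) (by simp))
    ((contMDiff_meridianDisk (p := p) j z).mdifferentiableAt (x := (0 : ℂ)) (by simp))
  rw [h1.mfderiv_eq, L.hasMFDerivAt.mfderiv] at h2
  have h4 : L a = ((√(b j) : ℂ)⁻¹ * a) * (z ^ p j : Circle) := by
    simp only [L, ContinuousLinearMap.mul_apply']; ring
  rw [← h4]
  have h0 : core j z = meridianDisk D p j z 0 :=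
    (torus_of_eq (q := (z, 0)) rfl).symm
  exact (mfderiv_congr_point _ h0 _).trans (congrArg (fun A : ℂ →L[ℝ] ℂ => A a) h2).symm

/-- Over a point of a disc, a 1-form takes opposite values on the meridian of the fibre and on the
vector field `λ - p μ` of the surgery torus. -/
theorem apply_meridian (α : OneForm Model3 (SeifertManifold D p)) (j : J) (l : Circle) {v : ℂ}
    (hv : v ≠ 0) :
    α (page D p l (D.puncturedDisk j v)) (mfderiv 𝓘(ℝ, ℂ) Model3 (page D p l) (D.puncturedDisk j v)
      (mfderiv 𝓘(ℝ, ℂ) 𝓘(ℝ, ℂ) (D.puncturedDisk j) v (Complex.I * v))) =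
    - onVelocity α fun t => torus D p j (Circle.exp (1 * t) * (glueInv (p j) (l, v)).1,
      (Circle.exp (-(p j : ℝ) * t) : ℂ) * (glueInv (p j) (l, v)).2) := by
  have hδ := (D.contMDiffAt_puncturedDisk j hv).mdifferentiableAt (by simp)
  have hp := (contMDiff_page (D := D) (p := p) l).mdifferentiableAt (x := D.puncturedDisk j v)
    (by simp)
  have h1 : HasDerivAt (fun t : ℝ => (Circle.exp (1 * t) : ℂ) * v) (Complex.I * v) 0 :=
    (hasDerivAt_coe_exp 1 v).congr_deriv (by push_cast; ring)
  have h2 := onVelocity_comp α (hp.comp v hδ) h1 (by simp)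
  have h3 : mfderiv 𝓘(ℝ, ℂ) Model3 (page D p l ∘ D.puncturedDisk j) v (Complex.I * v) =
      mfderiv 𝓘(ℝ, ℂ) Model3 (page D p l) (D.puncturedDisk j v)
      (mfderiv 𝓘(ℝ, ℂ) 𝓘(ℝ, ℂ) (D.puncturedDisk j) v (Complex.I * v)) := by
    rw [mfderiv_comp v hp hδ]; rfl
  rw [← h3]
  refine h2.symm.trans ?_
  rcases hzw : glueInv (p j) (l, v) with ⟨z, w⟩
  dsimp only
  have hw : w ≠ 0 := by
    have := (glueInv_snd_ne_zero (p := p j) (q := (l, v))).2 hv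
    rwa [hzw] at this
  have hg : glue (p j) (z, w) = (l, v) := by rw [← hzw]; exact glue_glueInv hv
  have h4 : (fun t : ℝ => (page D p l ∘ D.puncturedDisk j) ((Circle.exp (1 * t) : ℂ) * v)) =
      fun t => torus D p j (Circle.exp (-1 * t) * z, (Circle.exp (p j * t) : ℂ) * w) := by
    funext t
    have ht := glue_meridian (p j) z hw t
    rw [hg] at ht
    have hne : (Circle.exp (1 * t) : ℂ) * v ≠ 0 := mul_ne_zero (Circle.coe_ne_zero _) hv
    rw [torus_of_ne (mul_ne_zero (Circle.coe_ne_zero _) hw), Function.comp_apply, page,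
      D.puncturedDisk_of_ne j hne, outer.injEq]
    ext1
    · exact (congrArg Prod.fst ht).symm
    · ext1
      have := congrArg (fun q => D.disk j q.2) ht
      exact (congrArg (fun s : ℝ => D.disk j ((Circle.exp s : ℂ) * v)) (one_mul t)).trans this.symm
  rw [h4]
  -- Both curves are images of lines in the cover, with opposite directions.
  have h5 := onVelocity_torus α j (-1) (p j) (Complex.arg z) w
  have h6 := onVelocity_torus α j 1 (-(p j : ℝ)) (Complex.arg z) w
  rw [Circle.exp_arg] at h5 h6
  rw [h5, h6]
  have h7 : (((-1 : ℝ), ((p j : ℝ) : ℂ) * Complex.I * w) : ℝ × ℂ) =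
      -((1, ((-(p j : ℝ) : ℝ) : ℂ) * Complex.I * w) : ℝ × ℂ) := by
    ext <;> simp
  rw [h7]
  exact (congrArg _ (map_neg (mfderiv 𝓘(ℝ, ℝ × ℂ) Model3 (torusCover D p j) _) _)).trans
    (map_neg (α (torusCover D p j _)) _)

/-- The form `α ∧ dr` is nonnegative on the pages, where `r` is the function `D.radius b`, if `α` is
positive on `λ - p μ` near the binding. -/
theorem wedge_dradius_nonneg {α : OneForm Model3 (SeifertManifold D p)} {ε : J → ℝ}
    (hε : ∀ j, 0 < ε j)
    (hpos : ∀ (j : J) (z : Circle) (w : ℂ), ‖w‖ ≤ ε j → 0 < onVelocity α fun t =>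
      torus D p j (Circle.exp (1 * t) * z, (Circle.exp (-(p j : ℝ) * t) : ℂ) * w))
    (l : Circle) (x : D.punctured) :
    0 ≤ α (page D p l x) (mfderiv 𝓘(ℝ, ℂ) Model3 (page D p l) x (1 : ℂ)) *
        dradius D (fun j => ε j ^ 2) x Complex.I -
      α (page D p l x) (mfderiv 𝓘(ℝ, ℂ) Model3 (page D p l) x Complex.I) *
        dradius D (fun j => ε j ^ 2) x 1 := by
  have hb : ∀ j, 0 < ε j ^ 2 := fun j => pow_pos (hε j) 2
  by_cases h : ∃ j v, D.disk j v = x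
  · obtain ⟨j, v, hvx⟩ := h
    have hv : v ≠ 0 := by
      rintro rfl
      exact x.2 ⟨j, hvx⟩
    obtain rfl : D.puncturedDisk j v = x := by
      rw [D.puncturedDisk_of_ne j hv]; exact Subtype.ext hvx
    set A : ℂ →L[ℝ] ℂ := mfderiv 𝓘(ℝ, ℂ) 𝓘(ℝ, ℂ) (D.puncturedDisk j) v
    set a : ℂ →L[ℝ] ℝ := (α (page D p l (D.puncturedDisk j v))).comp
      (mfderiv 𝓘(ℝ, ℂ) Model3 (page D p l) (D.puncturedDisk j v))
    set dr := dradius D (fun j => ε j ^ 2) (D.puncturedDisk j v)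
    obtain ⟨κ, hκ, hκ0, hfd⟩ := DiskSystem.exists_fderiv_profile_eq (hb j) hv
    have hdrA : ∀ w, dr (A w) = κ * (v.re * w.re + v.im * w.im) := by
      intro w
      rw [← hfd]
      have h1 : (fun x : D.punctured => D.radius (fun j => ε j ^ 2) x) ∘ D.puncturedDisk j =ᶠ[𝓝 v]
          fun v => profile (ε j ^ 2) (‖v‖ ^ 2) := by
        filter_upwards [isOpen_ne.mem_nhds hv] with u hu
        rw [Function.comp_apply, D.puncturedDisk_of_ne j hu, D.radius_disk]
      have h2 := mfderiv_comp v (I' := 𝓘(ℝ, ℂ))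
        ((contMDiffAt_radius_punctured hb (D.puncturedDisk j v)).mdifferentiableAt (by simp))
        ((D.contMDiffAt_puncturedDisk j hv).mdifferentiableAt (by simp))
      rw [h1.mfderiv_eq, mfderiv_eq_fderiv] at h2
      exact (congrArg (fun L : ℂ →L[ℝ] ℝ => L w) h2).symm
    have hdet : 0 < A.det := D.det_mfderiv_puncturedDisk_pos j hv
    -- In the coordinate `v` the form `dr` is `κ ⟪v, ·⟫`, so that `α ∧ dr` is `- κ α (i v)`, and `i v`
    -- is the meridian.
    have hw := wedge_comp_eq_det_mul A a dr
    have hm := apply_meridian α j l hv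
    have hIv : a (A (Complex.I * v)) = v.re * a (A Complex.I) - v.im * a (A 1) := by
      have : Complex.I * v = v.re • Complex.I - v.im • (1 : ℂ) := by
        apply Complex.ext <;> simp
      rw [this, map_sub, map_sub, map_smul, map_smul, map_smul, map_smul, smul_eq_mul, smul_eq_mul]
    have hle : κ * a (A (Complex.I * v)) ≤ 0 := by
      rcases lt_or_ge (ε j ^ 2) (‖v‖ ^ 2) with hlt | hge
      · rw [hκ0 hlt, zero_mul]
      · refine mul_nonpos_of_nonneg_of_nonpos hκ ?_
        refine hm.trans_le (neg_nonpos.2 (hpos j _ _ ?_).le)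
        have hn : ‖(glueInv (p j) (l, v)).2‖ = ‖v‖ := by
          simp only [glueInv, norm_mul, Circle.norm_coe, mul_one, Complex.norm_real, norm_norm]
        rw [hn]
        exact le_of_sq_le_sq hge (hε j).le
    have hgoal : 0 ≤ a 1 * dr Complex.I - a Complex.I * dr 1 := by
      refine nonneg_of_mul_nonneg_right ?_ hdet
      rw [← hw, hdrA, hdrA]
      simp only [Complex.one_re, Complex.one_im, Complex.I_re, Complex.I_im]
      rw [hIv] at hle
      linarith
    exact hgoal
  · push Not at h
    have h1 : (fun x : D.punctured => D.radius (fun j => ε j ^ 2) x) =ᶠ[𝓝 x] fun _ => 1 :=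
      (D.radius_eventuallyEq_one hb fun j v hv => absurd hv (h j v)).comp_tendsto
        continuous_subtype_val.continuousAt
    have h2 : dradius D (fun j => ε j ^ 2) x = 0 := by
      rw [dradius, h1.mfderiv_eq]
      exact mfderiv_const
    simp [h2]

end SeifertManifold

open SeifertManifold

variable {D : DiskSystem S J} {p : J → ℤ}

/-- Adding a nonnegative multiple of `r² dθ` to a contact form compatible with the open book gives a
contact form, provided that `r` is constant outside a small neighbourhood of the binding. -/
theorem isContactForm_add_smul_angularForm {α : OneForm Model3 (SeifertManifold D p)}
    (hα : IsContactForm α) (hbind : ∀ j z, 0 < α (core j z) (bindingVector D p j z))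
    (hpage : ∀ l x, 0 < α.d (page D p l x) (mfderiv 𝓘(ℝ, ℂ) Model3 (page D p l) x (1 : ℂ))
      (mfderiv 𝓘(ℝ, ℂ) Model3 (page D p l) x Complex.I)) {ε : J → ℝ} (hε : ∀ j, 0 < ε j)
    (hpos : ∀ (j : J) (z : Circle) (w : ℂ), ‖w‖ ≤ ε j → 0 < onVelocity α fun t =>
      torus D p j (Circle.exp (1 * t) * z, (Circle.exp (-(p j : ℝ) * t) : ℂ) * w))
    {c : ℝ} (hc : 0 ≤ c) :
    IsContactForm (α + c • angularForm Model3 (openBookMap D p fun j => ε j ^ 2)) := by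
  have hb : ∀ j, 0 < ε j ^ 2 := fun j => pow_pos (hε j) 2
  have hF := contMDiff_openBookMap (D := D) (p := p) hb
  refine ⟨isSmooth_add_smul_angularForm hα.1 hF c, fun y => ?_⟩
  rw [wedgeD_add_smul_angularForm hα.1 hF]
  refine add_pos_of_pos_of_nonneg (hα.2 y) (mul_nonneg hc ?_)
  cases y with
  | outer q =>
    obtain ⟨l, x⟩ := q
    set r := D.radius (fun j => ε j ^ 2) x
    have hr0 : 0 ≤ r := D.radius_nonneg hb x
    have hFy : openBookMap D p (fun j => ε j ^ 2) (outer (l, x)) = r * l := rfl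
    have h0 : mfderiv Model3 𝓘(ℝ, ℂ) (openBookMap D p fun j => ε j ^ 2) (outer (l, x))
        (positiveFrame (outer (l, x)) 0) = ((Complex.I * r) * l : ℂ) :=
      mfderiv_openBookMap_fiberVector hb l x
    have h1 : mfderiv Model3 𝓘(ℝ, ℂ) (openBookMap D p fun j => ε j ^ 2) (outer (l, x))
        (positiveFrame (outer (l, x)) 1) =
          ((dradius D (fun j => ε j ^ 2) x 1 : ℂ) * l : ℂ) :=
      mfderiv_openBookMap_page hb l x 1
    have h2 : mfderiv Model3 𝓘(ℝ, ℂ) (openBookMap D p fun j => ε j ^ 2) (outer (l, x))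
        (positiveFrame (outer (l, x)) 2) =
          ((dradius D (fun j => ε j ^ 2) x Complex.I : ℂ) * l : ℂ) :=
      mfderiv_openBookMap_page hb l x Complex.I
    have hd : 0 < α.d (outer (l, x)) (positiveFrame (outer (l, x)) 1)
        (positiveFrame (outer (l, x)) 2) := hpage l x
    have hw : 0 ≤ α (outer (l, x)) (positiveFrame (outer (l, x)) 1) *
        dradius D (fun j => ε j ^ 2) x Complex.I -
        α (outer (l, x)) (positiveFrame (outer (l, x)) 2) * dradius D (fun j => ε j ^ 2) x 1 :=
      wedge_dradius_nonneg hε hpos l x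
    simp only [angularForm_apply]
    rw [h0, h1, h2, hFy]
    simp only [areaForm_mul_circle]
    simp only [areaForm_apply, Complex.ofReal_re, Complex.ofReal_im, Complex.mul_re,
      Complex.mul_im, Complex.I_re, Complex.I_im]
    -- These are `β ∧ dα` and half of `α ∧ dβ`.
    have h3 := mul_nonneg (sq_nonneg r) hd.le
    have h4 := mul_nonneg hr0 hw
    nlinarith
  | core j z =>
    have hFy : openBookMap D p (fun j => ε j ^ 2) (core j z) = 0 := rfl
    have h0 : mfderiv Model3 𝓘(ℝ, ℂ) (openBookMap D p fun j => ε j ^ 2) (core j z)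
        (positiveFrame (core j z) 0) = (0 : ℂ) := mfderiv_openBookMap_bindingVector hb j z
    have h1 : mfderiv Model3 𝓘(ℝ, ℂ) (openBookMap D p fun j => ε j ^ 2) (core j z)
        (positiveFrame (core j z) 1) =
          (((√(ε j ^ 2) : ℂ)⁻¹ * 1) * (z ^ p j : Circle) : ℂ) :=
      mfderiv_openBookMap_meridianDisk hb j z 1
    have h2 : mfderiv Model3 𝓘(ℝ, ℂ) (openBookMap D p fun j => ε j ^ 2) (core j z)
        (positiveFrame (core j z) 2) =
          (((√(ε j ^ 2) : ℂ)⁻¹ * Complex.I) * (z ^ p j : Circle) : ℂ) :=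
      mfderiv_openBookMap_meridianDisk hb j z Complex.I
    have hbd : 0 < α (core j z) (positiveFrame (core j z) 0) := hbind j z
    simp only [angularForm_apply]
    rw [h0, h1, h2, hFy]
    simp only [areaForm_mul_circle]
    simp only [areaForm_apply, ← Complex.ofReal_inv, Complex.ofReal_re, Complex.ofReal_im,
      Complex.mul_re, Complex.mul_im, Complex.I_re, Complex.I_im, Complex.zero_re, Complex.zero_im,
      Complex.one_re, Complex.one_im]
    have h3 := mul_nonneg hbd.le (mul_self_nonneg (√(ε j ^ 2))⁻¹)
    nlinarith

/-- The contact structure compatible with the open book is horizontal if all surgery coefficients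
are positive. -/
theorem exists_isHorizontal [CompactSpace S] (hp : ∀ j, 0 < p j)
    (ξ : CoorientedPlaneField Model3 (SeifertManifold D p)) (hξ : IsCompatible ξ) :
    ∃ ξ' : CoorientedPlaneField Model3 (SeifertManifold D p),
      ContactIsotopic ξ ξ' ∧ IsCompatible ξ' ∧ IsHorizontal ξ' := by
  obtain ⟨α, hα, hker, hbind, hpage⟩ := hξ
  -- The radii of the discs are such that `α` is positive both on `λ - p μ` and on the fibres
  -- `p λ - (p² - 1) μ`.
  have hε : ∀ j, ∃ ε > 0,
      (∀ (z : Circle) (w : ℂ), ‖w‖ ≤ ε → 0 < onVelocity α fun t =>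
        torus D p j (Circle.exp (1 * t) * z, (Circle.exp (-(p j : ℝ) * t) : ℂ) * w)) ∧
      ∀ (z : Circle) (w : ℂ), ‖w‖ ≤ ε → 0 < onVelocity α (fiberCurve (torus D p j (z, w))) := by
    intro j
    obtain ⟨ε₁, hε₁, h₁⟩ := exists_pos_near_core hα.1 j (-(p j : ℝ)) one_pos (hbind j)
    obtain ⟨ε₂, hε₂, h₂⟩ := exists_pos_near_core hα.1 j (-((p j : ℝ) ^ 2 - 1))
      (Int.cast_pos.2 (hp j)) (hbind j)
    refine ⟨min ε₁ ε₂, lt_min hε₁ hε₂, fun z w hw => h₁ z w (hw.trans (min_le_left _ _)),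
      fun z w hw => ?_⟩
    rw [funext (fiberCurve_torus j z w)]
    exact h₂ z w (hw.trans (min_le_right _ _))
  choose ε hε hpos hfib using hε
  have hb : ∀ j, 0 < ε j ^ 2 := fun j => pow_pos (hε j) 2
  obtain ⟨C, hC, hbound⟩ := exists_bound_onVelocity_fiberCurve hα.1 hε
  set F := openBookMap D p fun j => ε j ^ 2
  have hF : ContMDiff Model3 𝓘(ℝ, ℂ) ∞ F := contMDiff_openBookMap hb
  -- Where `r = 1` the form `α` is at least `-C` on the fibres, and `C + 1` is added.
  set α' := α + (C + 1) • angularForm Model3 F with hα'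
  have hval : ∀ y (v : TangentSpace Model3 y),
      α' y v = α y v + (C + 1) * angularForm Model3 F y v := fun y v => rfl
  have hcore : ∀ j z (v : TangentSpace Model3 (core j z : SeifertManifold D p)),
      α' (core j z) v = α (core j z) v := by
    intro j z v
    have h0 : F (core j z) = 0 := rfl
    rw [hval, angularForm_apply, h0, map_zero]
    exact add_eq_left.2 (mul_zero _)
  have hcontact : ∀ t ∈ Set.Icc (0 : ℝ) 1,
      IsContactForm (α + (t * (C + 1)) • angularForm Model3 F) := fun t ht =>
    isContactForm_add_smul_angularForm hα hbind hpage hε hpos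
      (mul_nonneg ht.1 (by linarith))
  have hcontact' : IsContactForm α' := by
    simpa using hcontact 1 ⟨zero_le_one, le_rfl⟩
  let ξ' : CoorientedPlaneField Model3 (SeifertManifold D p) :=
    ⟨fun y => LinearMap.ker (α' y).toLinearMap, fun y => {v | 0 < α' y v}⟩
  have hker' : ξ'.IsKernel α' := fun y v => ⟨LinearMap.mem_ker, Iff.rfl⟩
  refine ⟨ξ', ?_, ?_, ?_⟩
  · refine ⟨fun t => α + (t * (C + 1)) • angularForm Model3 F,
      isSmoothFamily_add_smul_angularForm hα.1 hF (C + 1), hcontact, ?_, ?_⟩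
    · simpa using hker
    · simpa using hker'
  · refine ⟨α', hcontact', hker', fun j z => ?_, fun l x => ?_⟩
    · rw [hcore]; exact hbind j z
    · rw [hα', d_add_smul_angularForm hα.1 hF, mfderiv_openBookMap_page hb,
        mfderiv_openBookMap_page hb, areaForm_mul_circle]
      simpa [areaForm_apply] using hpage l x
  · have hfiber : ∀ y, 0 < α' y (fiberVector y) := by
      intro y
      cases y with
      | core j z =>
        rw [hcore, apply_fiberVector, ← torus_of_eq (D := D) (p := p) (q := (z, 0)) rfl]
        exact hfib j z 0 (by simpa using (hε j).le)
      | outer q =>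
        obtain ⟨l, x⟩ := q
        have hβ : angularForm Model3 F (outer (l, x)) (fiberVector (outer (l, x))) =
            D.radius (fun j => ε j ^ 2) x ^ 2 := by
          have h0 : F (outer (l, x)) = (D.radius (fun j => ε j ^ 2) x : ℂ) * l := rfl
          rw [angularForm_apply, mfderiv_openBookMap_fiberVector hb, h0, areaForm_mul_circle]
          simp [areaForm_apply, sq]
        rw [hval, hβ, apply_fiberVector]
        by_cases h : ∀ j v, D.disk j v = x → ε j ≤ ‖v‖
        · have h1 := hbound l x h
          have h2 : D.radius (fun j => ε j ^ 2) x = 1 := D.radius_eq_one hb fun j v hv =>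
            pow_le_pow_left₀ (hε j).le (h j v hv) 2
          rw [h2]; linarith
        · push Not at h
          obtain ⟨j, v, hvx, hlt⟩ := h
          have hv : v ≠ 0 := by
            rintro rfl
            exact x.2 ⟨j, hvx⟩
          have hg := glue_glueInv (p := p j) (q := (l, v)) hv
          have h2 : (outer (l, x) : SeifertManifold D p) = torus D p j (glueInv (p j) (l, v)) := by
            rw [torus_of_ne (glueInv_snd_ne_zero.2 hv), outer.injEq]
            ext1
            · exact (congrArg Prod.fst hg).symm
            · ext1
              exact ((congrArg (fun q => D.disk j q.2) hg).trans hvx).symm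
          have hn : ‖(glueInv (p j) (l, v)).2‖ = ‖v‖ := by
            simp only [glueInv, norm_mul, Circle.norm_coe, mul_one, Complex.norm_real, norm_norm]
          rw [h2]
          exact add_pos_of_pos_of_nonneg (hfib j _ _ (hn.trans_le hlt.le))
            (mul_nonneg (by linarith) (sq_nonneg _))
    exact fun y => ⟨fun h => (hfiber y).ne' ((hker' y _).1.1 h), (hker' y _).2.2 (hfiber y)⟩

end

theorem surgeryCoefficient_pos (n : ℤ) {k : ℕ} {r : Fin k → ℚ}
    (hr : ∀ i, ∃ m : ℕ, 0 < m ∧ -1 / r i = (m : ℚ)) (j : Fin n.natAbs ⊕ Fin k) :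
    0 < surgeryCoefficient n r j := by
  cases j with
  | inl i => exact one_pos
  | inr i =>
    obtain ⟨m, hm, h⟩ := hr i
    change 0 < ⌊-1 / r i⌋
    rw [h, Int.floor_natCast]
    exact_mod_cast hm

end SeifertOpenBook
end

theorem proposition3p2 {S : Type*} [TopologicalSpace S] [T2Space S] [CompactSpace S]
    [ConnectedSpace S] [ChartedSpace ℂ S] [IsManifold 𝓘(ℝ, ℂ) ∞ S]
    [SeifertOpenBook.OrientedAtlas S]
    (n : ℤ) (hn : n ≤ 0) (k : ℕ) (r : Fin k → ℚ)
    (hr : ∀ i, ∃ m : ℕ, 0 < m ∧ -1 / r i = (m : ℚ))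
    (D : SeifertOpenBook.DiskSystem S (Fin n.natAbs ⊕ Fin k))
    (ξ : SeifertOpenBook.CoorientedPlaneField SeifertOpenBook.Model3
      (SeifertOpenBook.SeifertManifold D (SeifertOpenBook.surgeryCoefficient n r)))
    (hξ : SeifertOpenBook.IsCompatible ξ) :
    ∃ ξ' : SeifertOpenBook.CoorientedPlaneField SeifertOpenBook.Model3
        (SeifertOpenBook.SeifertManifold D (SeifertOpenBook.surgeryCoefficient n r)),
      SeifertOpenBook.ContactIsotopic ξ ξ' ∧ SeifertOpenBook.IsCompatible ξ' ∧
        SeifertOpenBook.IsHorizontal ξ' :=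
  SeifertOpenBook.exists_isHorizontal (SeifertOpenBook.surgeryCoefficient_pos n hr) ξ hξ
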